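/- **Theorem 3.1.** Let $C$ be a closed densely defined linear operator in a complex Hilbert space $\mathcal H$ (products of operators are taken on their maximal domains, and $A\subseteq B$ means that the graph of $A$ is contained in the graph of $B$). Then $I+C^*C$ maps the domain of $C^*C$ bijectively onto $\mathcal H$, the positive selfadjoint square root $|C|$ of $C^*C$ exists, and $|C|$ has a spectral measure $E_{|C|}$ on the Borel sets of $\mathbb R$. Moreover, the following conditions are equivalent: 1. $CC^*C\subseteq C^*CC$; 2. $CC^*C=C^*CC$ (that is, $C$ is quasinormal in the sense of Kaufman); 3. $(I+C^*C)^{-1}C\subseteq C(I+C^*C)^{-1}$; 4. $E_{|C|}C\subseteq CE_{|C|}$, i.e. $E_{|C|}(\Delta)C\subseteq CE_{|C|}(\Delta)$ for every Borel set $\Delta\subseteq\mathbb R$ (that is, $C$ is quasinormal in the sense of Stochel and Szafraniec). In particular, the two definitions of quasinormality for closed densely defined operators coincide. -/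

import Mathlib

open scoped LinearPMap

noncomputable section

/-! ### Partially defined operators -/

section Operators

variable {H : Type*} [NormedAddCommGroup H] [InnerProductSpace ℂ H]

/-- The product `B A` of two operators in `H`, on its maximal domain
`{x ∈ D(A) | A x ∈ D(B)}`. -/
def LinearPMap.pcomp (B A : H →ₗ.[ℂ] H) : H →ₗ.[ℂ] H where
  domain :=
    { carrier := {x | ∃ h : x ∈ A.domain, A ⟨x, h⟩ ∈ B.domain}
      zero_mem' := ⟨A.domain.zero_mem, by
        have h0 : A ⟨0, A.domain.zero_mem⟩ = 0 := A.map_zero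
        rw [h0]; exact B.domain.zero_mem⟩
      add_mem' := by
        rintro x y ⟨hx, hx'⟩ ⟨hy, hy'⟩
        refine ⟨A.domain.add_mem hx hy, ?_⟩
        have h := A.map_add ⟨x, hx⟩ ⟨y, hy⟩
        rw [show (⟨x + y, A.domain.add_mem hx hy⟩ : A.domain) = ⟨x, hx⟩ + ⟨y, hy⟩ from rfl, h]
        exact B.domain.add_mem hx' hy'
      smul_mem' := by
        rintro c x ⟨hx, hx'⟩
        refine ⟨A.domain.smul_mem c hx, ?_⟩
        have h := A.map_smul c ⟨x, hx⟩
        rw [show (⟨c • x, A.domain.smul_mem c hx⟩ : A.domain) = c • ⟨x, hx⟩ from rfl, h]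
        exact B.domain.smul_mem c hx' }
  toFun :=
    { toFun := fun x => B ⟨A ⟨x.1, x.2.choose⟩, x.2.choose_spec⟩
      map_add' := fun x y => by
        rw [← B.map_add]
        congr 1
        exact Subtype.ext (A.map_add ⟨x.1, x.2.choose⟩ ⟨y.1, y.2.choose⟩)
      map_smul' := fun c x => by
        rw [RingHom.id_apply, ← B.map_smul]
        congr 1
        exact Subtype.ext (A.map_smul c ⟨x.1, x.2.choose⟩) }

infixr:80 " ∘ₚ " => LinearPMap.pcomp

/-- A bounded operator on `H`, viewed as an operator in `H` with domain `H`. -/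
def ContinuousLinearMap.everywhere (T : H →L[ℂ] H) : H →ₗ.[ℂ] H :=
  (T : H →ₗ[ℂ] H).toPMap ⊤

variable [CompleteSpace H]

/-- `R` is a positive selfadjoint operator. -/
def LinearPMap.IsPositiveSelfAdjoint (R : H →ₗ.[ℂ] H) : Prop :=
  IsSelfAdjoint R ∧ ∀ x : R.domain, 0 ≤ (inner ℂ (x : H) (R x)).re

/-- `R` is the square root of `A`: the (unique) positive selfadjoint operator with `R R = A`. -/
def LinearPMap.IsSquareRootOf (R A : H →ₗ.[ℂ] H) : Prop :=
  R.IsPositiveSelfAdjoint ∧ R ∘ₚ R = A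

open scoped Classical in
/-- The modulus `|C|`, i.e. the square root of `C* C`
(junk value `0` if `C* C` has no square root). -/
def LinearPMap.modulus (C : H →ₗ.[ℂ] H) : H →ₗ.[ℂ] H :=
  if h : ∃ R : H →ₗ.[ℂ] H, R.IsSquareRootOf (C† ∘ₚ C) then h.choose else 0

end Operators

/-! ### Spectral measures -/

/-- A spectral Borel measure on `ℝ`: a map from the Borel sets to the orthogonal projections of
`H`, countably additive in the strong operator topology, with value `I` on `ℝ`. (As for vector
measures in Mathlib, the value at a set that is not Borel is `0` by convention.) -/
structure SpectralMeasure (H : Type*) [NormedAddCommGroup H] [InnerProductSpace ℂ H]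
    [CompleteSpace H] where
  proj : Set ℝ → H →L[ℂ] H
  isStarProjection : ∀ s, MeasurableSet s → IsStarProjection (proj s)
  not_measurable : ∀ s, ¬ MeasurableSet s → proj s = 0
  empty : proj ∅ = 0
  univ : proj Set.univ = 1
  hasSum_iUnion : ∀ s : ℕ → Set ℝ, (∀ i, MeasurableSet (s i)) →
    Pairwise (Function.onFun Disjoint s) →
    ∀ x : H, HasSum (fun i => proj (s i) x) (proj (⋃ i, s i) x)

namespace SpectralMeasure

variable {H : Type*} [NormedAddCommGroup H] [InnerProductSpace ℂ H] [CompleteSpace H]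

theorem inner_proj_nonneg (E : SpectralMeasure H) {s : Set ℝ} (hs : MeasurableSet s) (x : H) :
    0 ≤ (inner ℂ x (E.proj s x)).re := by
  have h := E.isStarProjection s hs
  have h1 : E.proj s x = E.proj s (E.proj s x) :=
    (congrArg (fun T : H →L[ℂ] H => T x) h.isIdempotentElem.eq).symm
  have h2 : ContinuousLinearMap.adjoint (E.proj s) = E.proj s := h.isSelfAdjoint
  rw [h1, ← ContinuousLinearMap.adjoint_inner_left, h2]
  exact inner_self_nonneg (𝕜 := ℂ)

/-- The finite Borel measure `⟨E(·) x, x⟩`. -/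
def scalarMeasure (E : SpectralMeasure H) (x : H) : MeasureTheory.Measure ℝ :=
  MeasureTheory.Measure.ofMeasurable
    (fun s _ => ENNReal.ofReal (inner ℂ x (E.proj s x)).re)
    (by simp [E.empty])
    (fun s hs hd => by
      have h1 : HasSum (fun i => (inner ℂ x (E.proj (s i) x)).re)
          (inner ℂ x (E.proj (⋃ i, s i) x)).re :=
        Complex.hasSum_re ((E.hasSum_iUnion s hs hd x).mapL (innerSL ℂ x))
      rw [← h1.tsum_eq]
      exact ENNReal.ofReal_tsum_of_nonneg (fun i => E.inner_proj_nonneg (hs i) x) h1.summable)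

theorem scalarMeasure_apply (E : SpectralMeasure H) (x : H) {s : Set ℝ} (hs : MeasurableSet s) :
    E.scalarMeasure x s = ENNReal.ofReal (inner ℂ x (E.proj s x)).re :=
  MeasureTheory.Measure.ofMeasurable_apply s hs

/-- `E` is the spectral measure of the selfadjoint operator `R`, that is `R = ∫ t E(dt)`: the
domain of `R` consists of the vectors `x` with `∫ t² ⟨E(dt) x, x⟩ < ∞`, and
`⟨R x, x⟩ = ∫ t ⟨E(dt) x, x⟩` for these `x` (which determines `R x` by polarization). -/
def IsSpectralMeasureOf (E : SpectralMeasure H) (R : H →ₗ.[ℂ] H) : Prop :=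
  (∀ x : H, x ∈ R.domain ↔ MeasureTheory.Integrable (fun t : ℝ => t ^ 2) (E.scalarMeasure x)) ∧
  ∀ x : R.domain, inner ℂ (x : H) (R x) = ((∫ t : ℝ, t ∂(E.scalarMeasure (x : H)) : ℝ) : ℂ)

open scoped Classical in
/-- The spectral measure concentrated at the point `a`. -/
def dirac (H : Type*) [NormedAddCommGroup H] [InnerProductSpace ℂ H] [CompleteSpace H] (a : ℝ) :
    SpectralMeasure H where
  proj s := if MeasurableSet s ∧ a ∈ s then 1 else 0
  isStarProjection s _ := by
    split_ifs
    · exact IsStarProjection.one _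
    · exact IsStarProjection.zero _
  not_measurable s hs := by simp [hs]
  empty := by simp
  univ := by simp
  hasSum_iUnion s hs hd x := by
    by_cases ha : ∃ i, a ∈ s i
    · obtain ⟨i, hi⟩ := ha
      have hU : MeasurableSet (⋃ j, s j) ∧ a ∈ ⋃ j, s j :=
        ⟨MeasurableSet.iUnion hs, Set.mem_iUnion.2 ⟨i, hi⟩⟩
      have hsum := hasSum_single (f := fun j =>
        (if MeasurableSet (s j) ∧ a ∈ s j then (1 : H →L[ℂ] H) else 0) x) i (fun j hj => by
          have hnot : a ∉ s j := fun h => Set.disjoint_left.1 (hd hj) h hi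
          simp [hnot])
      simpa [hU.2, hs i, hi, MeasurableSet.iUnion hs] using hsum
    · have hU : a ∉ ⋃ j, s j := fun h => ha (Set.mem_iUnion.1 h)
      have hn : ∀ i, a ∉ s i := fun i h => ha ⟨i, h⟩
      simp [hn, hasSum_zero]

end SpectralMeasure

section Quasinormal

variable {H : Type*} [NormedAddCommGroup H] [InnerProductSpace ℂ H] [CompleteSpace H]

open scoped Classical in
/-- The spectral measure `E_R` of a selfadjoint operator `R`
(junk value if `R` has no spectral measure). -/
def LinearPMap.spectralMeasure (R : H →ₗ.[ℂ] H) : SpectralMeasure H :=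
  if h : ∃ E : SpectralMeasure H, E.IsSpectralMeasureOf R then h.choose
  else SpectralMeasure.dirac H 0

/-- `E A ⊆ A E`, i.e. `E(Δ) A ⊆ A E(Δ)` for all Borel sets `Δ`. -/
def SpectralMeasure.CommutesWith (E : SpectralMeasure H) (A : H →ₗ.[ℂ] H) : Prop :=
  ∀ Δ : Set ℝ, MeasurableSet Δ →
    (E.proj Δ).everywhere ∘ₚ A ≤ A ∘ₚ (E.proj Δ).everywhere

/-- Quasinormality in the sense of Stochel and Szafraniec: `C` is closed, densely defined and
commutes with the spectral measure of `|C|`. -/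
def LinearPMap.IsQuasinormal (C : H →ₗ.[ℂ] H) : Prop :=
  C.IsClosed ∧ Dense (C.domain : Set H) ∧ C.modulus.spectralMeasure.CommutesWith C

/-- Quasinormality in the sense of Kaufman: `C` is closed, densely defined and
`C C* C = C* C C`. -/
def LinearPMap.IsKaufmanQuasinormal (C : H →ₗ.[ℂ] H) : Prop :=
  C.IsClosed ∧ Dense (C.domain : Set H) ∧ C ∘ₚ C† ∘ₚ C = C† ∘ₚ C ∘ₚ C

/-- The operator `(I + C* C)⁻¹`, whose domain is the range of `I + C* C`. -/
def LinearPMap.resolventStarMul (C : H →ₗ.[ℂ] H) : H →ₗ.[ℂ] H :=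
  ((1 : H →L[ℂ] H).everywhere + C† ∘ₚ C).inverse

end Quasinormal

end

/-!
# Quasinormality through the bounded operators `(I + C* C)⁻¹` and `C (I + C* C)⁻¹`

The orthogonal projection of `H × H` onto the graph of `C` has `T = (I + C* C)⁻¹` and `B = C T` in
its first column (`LinearPMap.exists_resolvent`). Every condition on the unbounded operator `C` is
a statement about this pair of bounded operators: `T C ⊆ C T` means `T B = B T`, and more generally
a bounded selfadjoint operator commutes with `C` if it commutes with `T` and `B`
(`LinearPMap.apply_mem_graph_of_commute`). Solving `x + C* C x = h` shows that `C C* C ⊆ C* C C`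
is the same as `T C ⊆ C T`. If `T B = B T`, then `C x = T z` gives `(I - T) x = B* C x = T B* z`,
so that `x` is in the range of `T` and `C* C x = B* z` is in the domain of `C`; this is the equality
`C C* C = C* C C`.

The square root of `C* C` is `T ^ (1/2) y ↦ (I - T) ^ (1/2) y`. Neither the uniqueness of square
roots nor that of spectral measures is needed: for any positive selfadjoint `R` with `R² = C* C` and
any spectral measure `E` of `R`, the operators `T` and `E(Δ)` commute with the same bounded
operators. In one direction, an operator `S` that commutes with `E` preserves the polarized scalar
measures, hence commutes with `R` and with `T` (`IsSpectralMeasureOf.commute_resolvent`). In the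
other direction, `Tⁿ` is at least `(1 + a²)⁻ⁿ` on the range of `E((-∞, a])` and at most
`(1 + b²)⁻ⁿ` on that of `E((b, ∞))`; if `S T = T S` and `a < b`, then letting `n → ∞` shows that
`S` maps no part of the first subspace into the second (`IsSpectralMeasureOf.commute_proj`).
Applied to `S = B` this relates the commutation of `C` with `E` to that of `T` with `B`.

A spectral measure of a positive selfadjoint `R` is the image of the one of `K = (I + R)⁻¹` under
`k ↦ k⁻¹ - 1`. For `K`, the Riesz–Markov–Kakutani theorem turns the continuous functional calculus
into scalar measures `μ x`, and `f ↦ f(K) x` is an isometry from `L²(μ x)` which can be evaluated on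
indicator functions (`exists_clm_indicator`).
-/

/-! ### Products and adjoints in terms of graphs -/

namespace LinearPMap

section Graph

variable {H : Type*} [NormedAddCommGroup H] [InnerProductSpace ℂ H]

theorem mem_graph_pcomp {A B : H →ₗ.[ℂ] H} {x z : H} :
    (x, z) ∈ (B ∘ₚ A).graph ↔ ∃ y, (x, y) ∈ A.graph ∧ (y, z) ∈ B.graph := by
  constructor
  · intro h
    obtain ⟨u, hu, hz⟩ := (mem_graph_iff _).1 h
    obtain ⟨hx, hy⟩ := u.2
    simp only at hu hz
    subst hu
    refine ⟨A ⟨u, hx⟩, mem_graph A ⟨u, hx⟩, ?_⟩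
    rw [← hz]
    exact mem_graph B ⟨_, hy⟩
  · rintro ⟨y, hxy, hyz⟩
    obtain ⟨u, hu, rfl⟩ := (mem_graph_iff _).1 hxy
    obtain ⟨v, hv, rfl⟩ := (mem_graph_iff _).1 hyz
    simp only at hu hv
    subst hu
    have hd : A u ∈ B.domain := hv ▸ v.2
    have hm : (u : H) ∈ (B ∘ₚ A).domain := ⟨u.2, hd⟩
    refine (mem_graph_iff _).2 ⟨⟨u, hm⟩, rfl, ?_⟩
    exact congrArg B (Subtype.ext hv.symm)

theorem mem_graph_everywhere {T : H →L[ℂ] H} {x y : H} :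
    (x, y) ∈ T.everywhere.graph ↔ y = T x := by
  constructor
  · intro h
    obtain ⟨u, hu, hy⟩ := (mem_graph_iff _).1 h
    simp only at hu hy
    rw [← hy, ← hu]; rfl
  · rintro rfl
    exact (mem_graph_iff _).2 ⟨⟨x, trivial⟩, rfl, rfl⟩

theorem le_iff_graph {A B : H →ₗ.[ℂ] H} :
    A ≤ B ↔ ∀ x y, (x, y) ∈ A.graph → (x, y) ∈ B.graph := by
  rw [← le_graph_iff]
  exact ⟨fun h x y hxy => h hxy, fun h p hp => h p.1 p.2 hp⟩

theorem ext_graph {A B : H →ₗ.[ℂ] H} (h : ∀ x y, (x, y) ∈ A.graph ↔ (x, y) ∈ B.graph) : A = B :=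
  eq_of_eq_graph (SetLike.ext fun p => h p.1 p.2)

theorem everywhere_pcomp_le_iff {S : H →L[ℂ] H} {C : H →ₗ.[ℂ] H} :
    S.everywhere ∘ₚ C ≤ C ∘ₚ S.everywhere ↔ ∀ x y, (x, y) ∈ C.graph → (S x, S y) ∈ C.graph := by
  simp only [le_iff_graph, mem_graph_pcomp, mem_graph_everywhere]
  constructor
  · intro h x y hxy
    obtain ⟨_, rfl, h2⟩ := h x (S y) ⟨y, hxy, rfl⟩
    exact h2
  · rintro h x _ ⟨y, hxy, rfl⟩
    exact ⟨S x, rfl, h x y hxy⟩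

theorem mem_graph_one_add {A : H →ₗ.[ℂ] H} {x z : H} :
    (x, z) ∈ ((1 : H →L[ℂ] H).everywhere + A).graph ↔ ∃ y, (x, y) ∈ A.graph ∧ z = x + y := by
  constructor
  · intro h
    obtain ⟨u, hu, hz⟩ := (mem_graph_iff _).1 h
    simp only at hu hz
    subst hu
    exact ⟨A ⟨u, u.2.2⟩, mem_graph A ⟨u, u.2.2⟩, hz.symm⟩
  · rintro ⟨y, hxy, rfl⟩
    obtain ⟨u, hu, rfl⟩ := (mem_graph_iff _).1 hxy
    simp only at hu
    subst hu
    exact (mem_graph_iff _).2 ⟨⟨u, trivial, u.2⟩, rfl, rfl⟩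

variable [CompleteSpace H]

theorem mem_graph_adjoint {C : H →ₗ.[ℂ] H} (hC : Dense (C.domain : Set H)) {v u : H} :
    (v, u) ∈ C†.graph ↔ ∀ x y, (x, y) ∈ C.graph → inner ℂ u x = inner ℂ v y := by
  rw [adjoint_graph_eq_graph_adjoint hC, Submodule.mem_adjoint_iff]
  constructor
  · intro h x y hxy
    have := h x y hxy
    rw [sub_eq_zero] at this
    rw [← inner_conj_symm, ← this, inner_conj_symm]
  · intro h x y hxy
    rw [sub_eq_zero, ← inner_conj_symm, ← h x y hxy, inner_conj_symm]

end Graph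

/-! ### The bounded operators `(I + C* C)⁻¹` and `C (I + C* C)⁻¹` -/

section Resolvent

variable {H : Type*} [NormedAddCommGroup H] [InnerProductSpace ℂ H] [CompleteSpace H]

/-- The orthogonal decomposition of `H × H` along the graph of a closed operator. -/
theorem exists_clm_graph_orthogonal {C : H →ₗ.[ℂ] H} (hC : C.IsClosed) :
    ∃ P₁ P₂ : H × H →L[ℂ] H, ∀ p : H × H, (P₁ p, P₂ p) ∈ C.graph ∧
      ∀ x y, (x, y) ∈ C.graph → inner ℂ (p.1 - P₁ p) x + inner ℂ (p.2 - P₂ p) y = 0 := by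
  let e : WithLp 2 (H × H) ≃L[ℂ] H × H := WithLp.prodContinuousLinearEquiv 2 ℂ H H
  let G : Submodule ℂ (WithLp 2 (H × H)) := C.graph.comap (e : WithLp 2 (H × H) →ₗ[ℂ] H × H)
  have hG : _root_.IsClosed (G : Set (WithLp 2 (H × H))) := hC.preimage e.continuous
  have : CompleteSpace G := hG.completeSpace_coe
  refine ⟨(ContinuousLinearMap.fst ℂ H H ∘L e.toContinuousLinearMap) ∘L G.starProjection ∘L
      e.symm.toContinuousLinearMap,
    (ContinuousLinearMap.snd ℂ H H ∘L e.toContinuousLinearMap) ∘L G.starProjection ∘L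
      e.symm.toContinuousLinearMap, fun p => ⟨?_, fun x y hxy => ?_⟩⟩
  · exact G.starProjection_apply_mem (e.symm p)
  · have hm : e.symm (x, y) ∈ G := by
      change e (e.symm (x, y)) ∈ C.graph
      rwa [e.apply_symm_apply]
    have h := Submodule.starProjection_inner_eq_zero (K := G) (e.symm p) _ hm
    rw [WithLp.prod_inner_apply] at h
    exact h

/-- The bounded operators `T = (I + C* C)⁻¹` and `B = C T`, obtained from the orthogonal projection
onto the graph of `C`. The last part says that the range of `B*` lies in the domain of `C` and
that `ker B*` is orthogonal to the range of `C`. -/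
theorem exists_resolvent {C : H →ₗ.[ℂ] H} (hC : C.IsClosed) (hd : Dense (C.domain : Set H)) :
    ∃ T B : H →L[ℂ] H, (∀ h, (T h, B h) ∈ C.graph ∧ (B h, h - T h) ∈ C†.graph) ∧
      ∀ h, ∃ d, (ContinuousLinearMap.adjoint B h, d) ∈ C.graph ∧
        (h - d, ContinuousLinearMap.adjoint B h) ∈ C†.graph := by
  obtain ⟨P₁, P₂, hP⟩ := exists_clm_graph_orthogonal hC
  refine ⟨P₁ ∘L .inl ℂ H H, P₂ ∘L .inl ℂ H H, ?_⟩
  set T : H →L[ℂ] H := P₁ ∘L .inl ℂ H H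
  set B : H →L[ℂ] H := P₂ ∘L .inl ℂ H H
  have h1 : ∀ h, (T h, B h) ∈ C.graph ∧ (B h, h - T h) ∈ C†.graph := by
    intro h
    obtain ⟨hg, ho⟩ := hP (h, 0)
    refine ⟨hg, (mem_graph_adjoint hd).2 fun x y hxy => ?_⟩
    have h3 := ho x y hxy
    change inner ℂ (h - T h) x + inner ℂ (0 - B h) y = 0 at h3
    rw [zero_sub, inner_neg_left, ← sub_eq_add_neg, sub_eq_zero] at h3
    exact h3
  refine ⟨h1, fun h => ?_⟩
  obtain ⟨hg, ho⟩ := hP (0, h)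
  set e := P₁ (0, h)
  set d := P₂ (0, h)
  have h2 : (h - d, e) ∈ C†.graph := by
    refine (mem_graph_adjoint hd).2 fun x y hxy => ?_
    have h3 := ho x y hxy
    change inner ℂ (0 - e) x + inner ℂ (h - d) y = 0 at h3
    rw [zero_sub, inner_neg_left, neg_add_eq_zero] at h3
    exact h3
  have he : ContinuousLinearMap.adjoint B h = e := by
    refine ext_inner_left ℂ fun k => ?_
    rw [ContinuousLinearMap.adjoint_inner_right]
    have h3 := (mem_graph_adjoint hd).1 (h1 k).2 _ _ hg
    have h4 := (mem_graph_adjoint hd).1 h2 _ _ (h1 k).1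
    rw [inner_sub_left] at h3
    have h5 : inner ℂ (T k) e = inner ℂ (B k) (h - d) := by
      rw [← inner_conj_symm, h4, inner_conj_symm]
    rw [inner_sub_right] at h5
    linear_combination -h3 - h5
  rw [he]
  exact ⟨d, hg, h2⟩

variable {C : H →ₗ.[ℂ] H} {T B : H →L[ℂ] H}

theorem eq_zero_of_one_add_starMul_eq_zero (hd : Dense (C.domain : Set H)) {x y z : H}
    (h1 : (x, y) ∈ C.graph) (h2 : (y, z) ∈ C†.graph) (h : x + z = 0) : x = 0 := by
  have h3 := (mem_graph_adjoint hd).1 h2 x y h1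
  rw [eq_neg_of_add_eq_zero_right h, inner_neg_left, inner_self_eq_norm_sq_to_K,
    inner_self_eq_norm_sq_to_K] at h3
  have h4 : -‖x‖ ^ 2 = ‖y‖ ^ 2 := by exact_mod_cast h3
  exact norm_eq_zero.1 (pow_eq_zero_iff two_ne_zero |>.1
    (le_antisymm (by nlinarith [sq_nonneg ‖y‖]) (sq_nonneg ‖x‖)))

theorem resolvent_apply (hd : Dense (C.domain : Set H))
    (hTB : ∀ h, (T h, B h) ∈ C.graph ∧ (B h, h - T h) ∈ C†.graph) {x y z : H}
    (h1 : (x, y) ∈ C.graph) (h2 : (y, z) ∈ C†.graph) : T (x + z) = x := by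
  have h3 := C.graph.sub_mem (hTB (x + z)).1 h1
  have h4 := C†.graph.sub_mem (hTB (x + z)).2 h2
  refine sub_eq_zero.1 (eq_zero_of_one_add_starMul_eq_zero hd h3 h4 ?_)
  change T (x + z) - x + (x + z - T (x + z) - z) = 0
  abel

theorem mem_graph_starMul_iff (hd : Dense (C.domain : Set H))
    (hTB : ∀ h, (T h, B h) ∈ C.graph ∧ (B h, h - T h) ∈ C†.graph) {x z : H} :
    (x, z) ∈ (C† ∘ₚ C).graph ↔ T (x + z) = x := by
  rw [mem_graph_pcomp]
  constructor
  · rintro ⟨y, h1, h2⟩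
    exact resolvent_apply hd hTB h1 h2
  · intro h
    have h1 := hTB (x + z)
    rw [h, add_sub_cancel_left] at h1
    exact ⟨_, h1⟩

theorem resolvent_injective
    (hTB : ∀ h, (T h, B h) ∈ C.graph ∧ (B h, h - T h) ∈ C†.graph) : Function.Injective T := by
  refine (injective_iff_map_eq_zero T).2 fun h h0 => ?_
  obtain ⟨h1, h2⟩ := hTB h
  rw [h0] at h1 h2
  rw [graph_fst_eq_zero_snd _ h1 rfl] at h2
  simpa using graph_fst_eq_zero_snd _ h2 rfl

theorem inner_resolvent (hd : Dense (C.domain : Set H))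
    (hTB : ∀ h, (T h, B h) ∈ C.graph ∧ (B h, h - T h) ∈ C†.graph) (h k : H) :
    inner ℂ h (T k) = inner ℂ (T h) (T k) + inner ℂ (B h) (B k) := by
  rw [← (mem_graph_adjoint hd).1 (hTB h).2 _ _ (hTB k).1, inner_sub_left, add_sub_cancel]

theorem isSelfAdjoint_resolvent (hd : Dense (C.domain : Set H))
    (hTB : ∀ h, (T h, B h) ∈ C.graph ∧ (B h, h - T h) ∈ C†.graph) : IsSelfAdjoint T := by
  rw [ContinuousLinearMap.isSelfAdjoint_iff_isSymmetric]
  intro h k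
  change inner ℂ (T h) k = inner ℂ h (T k)
  rw [inner_resolvent hd hTB, ← inner_conj_symm, inner_resolvent hd hTB]
  simp

theorem resolvent_nonneg (hd : Dense (C.domain : Set H))
    (hTB : ∀ h, (T h, B h) ∈ C.graph ∧ (B h, h - T h) ∈ C†.graph) : 0 ≤ T := by
  rw [ContinuousLinearMap.nonneg_iff_isPositive, ContinuousLinearMap.isPositive_def]
  refine ⟨(isSelfAdjoint_resolvent hd hTB).isSymmetric, fun x => ?_⟩
  rw [ContinuousLinearMap.reApplyInnerSelf_apply, inner_re_symm, inner_resolvent hd hTB]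
  exact add_nonneg (inner_self_nonneg (𝕜 := ℂ) (x := T x))
    (inner_self_nonneg (𝕜 := ℂ) (x := B x))

theorem resolvent_le_one (hd : Dense (C.domain : Set H))
    (hTB : ∀ h, (T h, B h) ∈ C.graph ∧ (B h, h - T h) ∈ C†.graph) : T ≤ 1 := by
  have hs := isSelfAdjoint_resolvent hd hTB
  rw [← sub_nonneg, ContinuousLinearMap.nonneg_iff_isPositive, ContinuousLinearMap.isPositive_def]
  refine ⟨((IsSelfAdjoint.one _).sub hs).isSymmetric, fun x => ?_⟩
  -- `⟨x - T x, x⟩ = ‖x - T x‖² + ‖B x‖²`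
  have h1 := inner_resolvent hd hTB x x
  have h2 : inner ℂ (x - T x) x = inner ℂ (x - T x) (x - T x) + inner ℂ (B x) (B x) := by
    have h3 : inner ℂ (T x) x = inner ℂ x (T x) := by
      conv_lhs => rw [← hs.adjoint_eq, ContinuousLinearMap.adjoint_inner_left]
    simp only [inner_sub_left, inner_sub_right, h3]
    linear_combination h1
  rw [ContinuousLinearMap.reApplyInnerSelf_apply]
  change 0 ≤ RCLike.re (inner ℂ (x - T x) x)
  rw [h2]
  exact add_nonneg (inner_self_nonneg (𝕜 := ℂ) (x := x - T x))
    (inner_self_nonneg (𝕜 := ℂ) (x := B x))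

theorem bijective_one_add_starMul (hd : Dense (C.domain : Set H))
    (hTB : ∀ h, (T h, B h) ∈ C.graph ∧ (B h, h - T h) ∈ C†.graph) :
    Function.Bijective ((1 : H →L[ℂ] H).everywhere + C† ∘ₚ C) := by
  constructor
  · intro x y hxy
    have hx := mem_graph ((1 : H →L[ℂ] H).everywhere + C† ∘ₚ C) x
    have hy := mem_graph ((1 : H →L[ℂ] H).everywhere + C† ∘ₚ C) y
    rw [mem_graph_one_add] at hx hy
    obtain ⟨u, hu, hu'⟩ := hx
    obtain ⟨v, hv, hv'⟩ := hy
    rw [mem_graph_starMul_iff hd hTB] at hu hv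
    rw [← hu'] at hu
    rw [← hv', ← hxy, hu] at hv
    exact Subtype.ext hv
  · intro z
    have h : (T z, z) ∈ ((1 : H →L[ℂ] H).everywhere + C† ∘ₚ C).graph :=
      mem_graph_one_add.2 ⟨z - T z, (mem_graph_starMul_iff hd hTB).2 (by simp), by simp⟩
    obtain ⟨u, -, hu⟩ := (mem_graph_iff _).1 h
    exact ⟨u, hu⟩

theorem resolventStarMul_eq (hd : Dense (C.domain : Set H))
    (hTB : ∀ h, (T h, B h) ∈ C.graph ∧ (B h, h - T h) ∈ C†.graph) :
    C.resolventStarMul = T.everywhere := by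
  refine ext_graph fun x y => ?_
  have hker : LinearMap.ker ((1 : H →L[ℂ] H).everywhere + C† ∘ₚ C).toFun = ⊥ :=
    LinearMap.ker_eq_bot.2 (bijective_one_add_starMul hd hTB).1
  have h1 : (x, y) ∈ C.resolventStarMul.graph ↔
      (y, x) ∈ ((1 : H →L[ℂ] H).everywhere + C† ∘ₚ C).graph := by
    rw [resolventStarMul, inverse_graph hker, Submodule.mem_map]
    constructor
    · rintro ⟨⟨a, b⟩, hp, hq⟩
      simp only [LinearEquiv.coe_coe, LinearEquiv.prodComm_apply, Prod.swap_prod_mk,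
        Prod.mk.injEq] at hq
      rwa [← hq.1, ← hq.2]
    · intro h
      exact ⟨(y, x), h, rfl⟩
  rw [h1, mem_graph_one_add, mem_graph_everywhere]
  constructor
  · rintro ⟨z, hz, rfl⟩
    exact ((mem_graph_starMul_iff hd hTB).1 hz).symm
  · rintro rfl
    exact ⟨x - T x, (mem_graph_starMul_iff hd hTB).2 (by simp), by simp⟩

/-- The first coordinate of the projection onto the graph of `C`, evaluated on the graph. -/
theorem resolvent_add_adjoint_apply (hd : Dense (C.domain : Set H))
    (hTB : ∀ h, (T h, B h) ∈ C.graph ∧ (B h, h - T h) ∈ C†.graph) {x y : H}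
    (hxy : (x, y) ∈ C.graph) : T x + ContinuousLinearMap.adjoint B y = x := by
  refine ext_inner_left ℂ fun k => ?_
  have h1 := (mem_graph_adjoint hd).1 (hTB k).2 _ _ hxy
  have h2 : inner ℂ k (T x) = inner ℂ (T k) x := by
    conv_lhs => rw [← (isSelfAdjoint_resolvent hd hTB).adjoint_eq,
      ContinuousLinearMap.adjoint_inner_right]
  rw [inner_add_right, ContinuousLinearMap.adjoint_inner_right, h2, ← h1, inner_sub_left,
    add_sub_cancel]

end Resolvent

/-! ### Existence of the square root -/

section SquareRoot

variable {H : Type*} [NormedAddCommGroup H] [InnerProductSpace ℂ H] [CompleteSpace H]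

theorem IsPositiveSelfAdjoint.inner_nonneg {R : H →ₗ.[ℂ] H}
    (hR : R.IsPositiveSelfAdjoint) {x x' : H}
    (hx : (x, x') ∈ R.graph) : 0 ≤ (inner ℂ x x').re := by
  obtain ⟨u, hu, hy⟩ := (mem_graph_iff _).1 hx
  simp only at hu hy
  rw [← hu, ← hy]
  exact hR.2 u

theorem _root_.IsSelfAdjoint.inner_apply_left {S : H →L[ℂ] H} (hS : IsSelfAdjoint S) (x y : H) :
    inner ℂ (S x) y = inner ℂ x (S y) :=
  hS.isSymmetric x y

theorem _root_.IsSelfAdjoint.denseRange_of_injective {S : H →L[ℂ] H} (hS : IsSelfAdjoint S)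
    (hi : Function.Injective S) : DenseRange S := by
  have h1 : (LinearMap.range (S : H →ₗ[ℂ] H)).topologicalClosure = ⊤ := by
    rw [Submodule.topologicalClosure_eq_top_iff, Submodule.eq_bot_iff]
    intro x hx
    refine hi ((ext_inner_left ℂ fun y => ?_).trans (_root_.map_zero S).symm)
    rw [← hS.inner_apply_left, inner_zero_right]
    exact (Submodule.mem_orthogonal _ _).1 hx _ ⟨y, rfl⟩
  exact Submodule.dense_iff_topologicalClosure_eq_top.2 h1

/-- If `S² + W² = I` for commuting positive bounded `S` and `W` with `S` injective, then
`S y ↦ W y` is a positive selfadjoint operator, whose square is `S² y ↦ W² y`. -/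
theorem exists_isPositiveSelfAdjoint_of_sq_add_sq {S W : H →L[ℂ] H} (hS : 0 ≤ S) (hW : 0 ≤ W)
    (hSW : Commute S W) (h1 : S * S + W * W = 1) (hi : Function.Injective S) :
    ∃ R : H →ₗ.[ℂ] H, R.IsPositiveSelfAdjoint ∧
      ∀ x y, (x, y) ∈ (R ∘ₚ R).graph ↔ S (S (x + y)) = x := by
  have hSa : IsSelfAdjoint S := .of_nonneg hS
  have hWa : IsSelfAdjoint W := .of_nonneg hW
  have hc : ∀ x, S (W x) = W (S x) := fun x => congrArg (fun T : H →L[ℂ] H => T x) hSW.eq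
  have h1' : ∀ x, S (S x) + W (W x) = x := fun x => congrArg (fun T : H →L[ℂ] H => T x) h1
  let R : H →ₗ.[ℂ] H := (LinearMap.range ((S.prod W : H →L[ℂ] H × H) : H →ₗ[ℂ] H × H)).toLinearPMap
  have hR : ∀ x y, (x, y) ∈ R.graph ↔ ∃ z, S z = x ∧ W z = y := by
    intro x y
    rw [Submodule.toLinearPMap_graph_eq]
    · simp [LinearMap.mem_range]
    · rintro ⟨a, b⟩ ⟨z, hz⟩ ha
      simp only [ContinuousLinearMap.coe_coe, ContinuousLinearMap.prod_apply,
        Prod.mk.injEq] at hz ha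
      rw [← hz.2, show z = 0 from hi (by rw [hz.1, ha, _root_.map_zero]), _root_.map_zero]
  have hd : Dense (R.domain : Set H) := by
    refine (hSa.denseRange_of_injective hi).mono ?_
    rintro _ ⟨z, rfl⟩
    exact mem_domain_of_mem_graph ((hR _ _).2 ⟨z, rfl, rfl⟩)
  have hadj : ∀ v u, (v, u) ∈ R†.graph ↔ S u = W v := by
    intro v u
    rw [mem_graph_adjoint hd]
    constructor
    · intro h
      refine ext_inner_right ℂ fun z => ?_
      rw [hSa.inner_apply_left, hWa.inner_apply_left]
      exact h _ _ ((hR _ _).2 ⟨z, rfl, rfl⟩)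
    · intro h x y hxy
      obtain ⟨z, rfl, rfl⟩ := (hR _ _).1 hxy
      rw [← hSa.inner_apply_left, ← hWa.inner_apply_left, h]
  refine ⟨R, ⟨?_, ?_⟩, ?_⟩
  · rw [isSelfAdjoint_def]
    refine ext_graph fun v u => ?_
    rw [hadj, hR]
    constructor
    · intro h
      refine ⟨S v + W u, ?_, ?_⟩
      · rw [_root_.map_add, hc, h, h1']
      · rw [_root_.map_add, ← hc, ← h, h1']
    · rintro ⟨z, rfl, rfl⟩
      exact hc z
  · rintro ⟨x, hx⟩
    obtain ⟨z, hz, hz'⟩ := (hR x _).1 (mem_graph R ⟨x, hx⟩)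
    rw [← hz']
    change 0 ≤ (inner ℂ x (W z)).re
    have h2 : 0 ≤ S * W := hSW.mul_nonneg hS hW
    rw [ContinuousLinearMap.nonneg_iff_isPositive] at h2
    have h3 := h2.re_inner_nonneg_right z
    rwa [mul_apply_eq_comp, ← hSa.inner_apply_left, hz] at h3
  · intro x y
    rw [mem_graph_pcomp]
    simp only [hR]
    constructor
    · rintro ⟨_, ⟨z, rfl, rfl⟩, w, hw, rfl⟩
      rw [_root_.map_add, hc w, hw, h1']
    · intro h
      refine ⟨_, ⟨S (x + y), h, rfl⟩, W (x + y), hc _, ?_⟩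
      have h2 := h1' (x + y)
      rw [h] at h2
      exact add_left_cancel h2

/-- `C* C` has a positive selfadjoint square root: with `T = (I + C* C)⁻¹` it is the operator
`T ^ (1/2) y ↦ (I - T) ^ (1/2) y`. -/
theorem exists_isSquareRootOf_starMul {C : H →ₗ.[ℂ] H} {T B : H →L[ℂ] H}
    (hd : Dense (C.domain : Set H))
    (hTB : ∀ h, (T h, B h) ∈ C.graph ∧ (B h, h - T h) ∈ C†.graph) :
    ∃ R : H →ₗ.[ℂ] H, R.IsSquareRootOf (C† ∘ₚ C) := by
  have hT := resolvent_nonneg hd hTB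
  have hT' : 0 ≤ 1 - T := sub_nonneg.2 (resolvent_le_one hd hTB)
  have hS2 : CFC.sqrt T * CFC.sqrt T = T := CFC.sqrt_mul_sqrt_self T hT
  have hW2 : CFC.sqrt (1 - T) * CFC.sqrt (1 - T) = 1 - T := CFC.sqrt_mul_sqrt_self _ hT'
  have hSS : ∀ x, CFC.sqrt T (CFC.sqrt T x) = T x :=
    fun x => congrArg (fun T : H →L[ℂ] H => T x) hS2
  have hcomm : Commute (CFC.sqrt T) (CFC.sqrt (1 - T)) := by
    have h1 : Commute T (1 - T) := (Commute.one_right T).sub_right (Commute.refl T)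
    exact ((h1.cfcₙ_nnreal _).symm.cfcₙ_nnreal _).symm
  obtain ⟨R, hR, hRR⟩ := exists_isPositiveSelfAdjoint_of_sq_add_sq (CFC.sqrt_nonneg T)
    (CFC.sqrt_nonneg (1 - T)) hcomm (by rw [hS2, hW2, add_sub_cancel]) (fun x y hxy =>
      resolvent_injective hTB (by rw [← hSS, ← hSS, hxy]))
  refine ⟨R, hR, ext_graph fun x y => ?_⟩
  rw [hRR, mem_graph_starMul_iff hd hTB, hSS]

end SquareRoot

/-! ### Commutation with `C` in terms of bounded operators -/

section Commutation

variable {H : Type*} [NormedAddCommGroup H] [InnerProductSpace ℂ H] [CompleteSpace H]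
variable {C : H →ₗ.[ℂ] H} {T B : H →L[ℂ] H}

/-- A bounded selfadjoint operator that commutes with `(I + C* C)⁻¹` and `C (I + C* C)⁻¹` commutes
with `C`. -/
theorem apply_mem_graph_of_commute (hd : Dense (C.domain : Set H))
    (hTB : ∀ h, (T h, B h) ∈ C.graph ∧ (B h, h - T h) ∈ C†.graph)
    (hB : ∀ h, ∃ d, (ContinuousLinearMap.adjoint B h, d) ∈ C.graph ∧
      (h - d, ContinuousLinearMap.adjoint B h) ∈ C†.graph)
    {S : H →L[ℂ] H} (hS : IsSelfAdjoint S) (hST : Commute S T) (hSB : Commute S B) {x y : H}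
    (hxy : (x, y) ∈ C.graph) : (S x, S y) ∈ C.graph := by
  have hT' : ∀ x, S (T x) = T (S x) := fun x => congrArg (fun T : H →L[ℂ] H => T x) hST.eq
  have hB' : ∀ x, S (ContinuousLinearMap.adjoint B x) = ContinuousLinearMap.adjoint B (S x) := by
    intro x
    refine ext_inner_left ℂ fun k => ?_
    rw [ContinuousLinearMap.adjoint_inner_right, ← hS.inner_apply_left,
      ContinuousLinearMap.adjoint_inner_right, ← hS.inner_apply_left]
    exact congrArg (fun T : H →L[ℂ] H => inner ℂ (T k) x) hSB.eq.symm
  obtain ⟨d, hd1, hd2⟩ := hB (S y)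
  -- `S x = T (S x) + B* (S y)` lies in the domain of `C`
  have h1 := C.graph.add_mem (hTB (S x)).1 hd1
  have h2 : T (S x) + ContinuousLinearMap.adjoint B (S y) = S x := by
    rw [← hT', ← hB', ← _root_.map_add, resolvent_add_adjoint_apply hd hTB hxy]
  change (T (S x) + ContinuousLinearMap.adjoint B (S y), B (S x) + d) ∈ C.graph at h1
  rw [h2] at h1
  -- the error `w` is orthogonal to the range of `C`
  set w := S y - (B (S x) + d)
  have hw : ∀ a b, (a, b) ∈ C.graph → inner ℂ w b = 0 := by
    intro a b hab
    have h3 := (mem_graph_adjoint hd).1 (C†.graph.sub_mem hd2 (hTB (S x)).2) a b hab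
    change inner ℂ (ContinuousLinearMap.adjoint B (S y) - (S x - T (S x))) a =
      inner ℂ (S y - d - B (S x)) b at h3
    rw [show S y - d - B (S x) = w from by simp only [w]; abel] at h3
    have h4 : ContinuousLinearMap.adjoint B (S y) - (S x - T (S x)) = 0 := by
      rw [sub_eq_zero, eq_sub_iff_add_eq', h2]
    rw [← h3, h4, inner_zero_left]
  have hker : ContinuousLinearMap.adjoint B w = 0 := by
    refine ext_inner_left ℂ fun k => ?_
    rw [ContinuousLinearMap.adjoint_inner_right, inner_zero_right, ← inner_conj_symm,
      hw _ _ (hTB k).1, _root_.map_zero]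
  have hker' : ContinuousLinearMap.adjoint B (S w) = 0 := by rw [← hB', hker, _root_.map_zero]
  have hw' : inner ℂ (S w) y = 0 := by
    obtain ⟨e, he1, he2⟩ := hB (S w)
    rw [hker'] at he1 he2
    rw [graph_fst_eq_zero_snd _ he1 rfl, sub_zero] at he2
    rw [← (mem_graph_adjoint hd).1 he2 _ _ hxy, inner_zero_left]
  have hw0 : w = 0 := by
    rw [← inner_self_eq_zero (𝕜 := ℂ)]
    conv_lhs => rw [show w = S y - (B (S x) + d) from rfl]
    change inner ℂ w (S y - (B (S x) + d)) = 0
    rw [inner_sub_right, hw _ _ h1, ← hS.inner_apply_left, hw', sub_zero]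
  rw [sub_eq_zero.1 hw0]
  exact h1

theorem commute_resolvent_iff (hd : Dense (C.domain : Set H))
    (hTB : ∀ h, (T h, B h) ∈ C.graph ∧ (B h, h - T h) ∈ C†.graph)
    (hB : ∀ h, ∃ d, (ContinuousLinearMap.adjoint B h, d) ∈ C.graph ∧
      (h - d, ContinuousLinearMap.adjoint B h) ∈ C†.graph) :
    (∀ x y, (x, y) ∈ C.graph → (T x, T y) ∈ C.graph) ↔ Commute T B := by
  constructor
  · intro h
    ext x
    exact mem_graph_snd_inj _ (h _ _ (hTB x).1) (hTB (T x)).1 rfl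
  · intro h x y hxy
    exact apply_mem_graph_of_commute hd hTB hB (isSelfAdjoint_resolvent hd hTB) (Commute.refl T) h
      hxy

/-- `C C* C ⊆ C* C C` implies `T C ⊆ C T` for `T = (I + C* C)⁻¹`. -/
theorem resolvent_apply_mem_graph_of_le (hd : Dense (C.domain : Set H))
    (hTB : ∀ h, (T h, B h) ∈ C.graph ∧ (B h, h - T h) ∈ C†.graph)
    (h : C ∘ₚ C† ∘ₚ C ≤ C† ∘ₚ C ∘ₚ C) {x y : H} (hxy : (x, y) ∈ C.graph) :
    (T x, T y) ∈ C.graph := by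
  have h1 : (x - T x, y - B x) ∈ C.graph := C.graph.sub_mem hxy (hTB x).1
  have h2 : (T x, y - B x) ∈ (C ∘ₚ C† ∘ₚ C).graph :=
    mem_graph_pcomp.2 ⟨_, mem_graph_pcomp.2 ⟨_, hTB x⟩, h1⟩
  have h3 := le_iff_graph.1 h _ _ h2
  simp only [mem_graph_pcomp] at h3
  obtain ⟨v, ⟨u, hu, huv⟩, hv⟩ := h3
  obtain rfl : u = B x := mem_graph_snd_inj _ hu (hTB x).1 rfl
  have h4 := resolvent_apply hd hTB huv hv
  rw [add_sub_cancel] at h4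
  rw [h4]
  exact hu

theorem le_of_resolvent_apply_mem_graph (hd : Dense (C.domain : Set H))
    (hTB : ∀ h, (T h, B h) ∈ C.graph ∧ (B h, h - T h) ∈ C†.graph)
    (h : ∀ x y, (x, y) ∈ C.graph → (T x, T y) ∈ C.graph) :
    C ∘ₚ C† ∘ₚ C ≤ C† ∘ₚ C ∘ₚ C := by
  refine le_iff_graph.2 fun x z hxz => ?_
  simp only [mem_graph_pcomp] at hxz ⊢
  obtain ⟨v, ⟨y, hxy, hyv⟩, hvz⟩ := hxz
  have h1 := h _ _ (C.graph.add_mem hxy hvz)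
  have h2 : (T (x + v), T (y + z)) ∈ C.graph := h1
  rw [resolvent_apply hd hTB hxy hyv] at h2
  have h3 : T (y + z) = y := mem_graph_snd_inj _ h2 hxy rfl
  obtain ⟨u, hu⟩ := mem_graph_pcomp.1 ((mem_graph_starMul_iff hd hTB).2 h3)
  exact ⟨u, ⟨y, hxy, hu.1⟩, hu.2⟩

/-- If `T = (I + C* C)⁻¹` commutes with `B = C T`, then `C C* C = C* C C`. The domain of `C* C C`
is contained in that of `C C* C`: from `C x = T z` and `B* C ⊆ I - T` one gets `x = T (x + B* z)`,
so that `C* C x = B* z`, which lies in the domain of `C`. -/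
theorem eq_of_commute_resolvent (hd : Dense (C.domain : Set H))
    (hTB : ∀ h, (T h, B h) ∈ C.graph ∧ (B h, h - T h) ∈ C†.graph)
    (hB : ∀ h, ∃ d, (ContinuousLinearMap.adjoint B h, d) ∈ C.graph ∧
      (h - d, ContinuousLinearMap.adjoint B h) ∈ C†.graph) (hc : Commute T B) :
    C ∘ₚ C† ∘ₚ C = C† ∘ₚ C ∘ₚ C := by
  have hle := le_of_resolvent_apply_mem_graph hd hTB ((commute_resolvent_iff hd hTB hB).2 hc)
  refine eq_of_le_of_domain_eq hle (le_antisymm hle.1 fun x hx => ?_)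
  obtain ⟨w, hw⟩ := mem_domain_iff.1 hx
  simp only [mem_graph_pcomp] at hw
  obtain ⟨v, ⟨y, hxy, hyv⟩, hvw⟩ := hw
  have hT := isSelfAdjoint_resolvent hd hTB
  have hTB' : ∀ z, T (ContinuousLinearMap.adjoint B z) = ContinuousLinearMap.adjoint B (T z) := by
    intro z
    refine ext_inner_left ℂ fun k => ?_
    rw [← hT.inner_apply_left, ContinuousLinearMap.adjoint_inner_right,
      ContinuousLinearMap.adjoint_inner_right, ← hT.inner_apply_left]
    exact congrArg (fun T : H →L[ℂ] H => inner ℂ (T k) z) hc.eq.symm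
  have h1 : T (y + w) = y := resolvent_apply hd hTB hyv hvw
  have h2 := resolvent_add_adjoint_apply hd hTB hxy
  rw [← h1, ← hTB', ← _root_.map_add] at h2
  obtain ⟨d, hd1, -⟩ := hB (y + w)
  exact mem_domain_of_mem_graph
    (mem_graph_pcomp.2 ⟨_, (mem_graph_starMul_iff hd hTB).2 h2, hd1⟩)

end Commutation

end LinearPMap

namespace SpectralMeasure

open MeasureTheory
open LinearPMap hiding map_add map_sub map_zero map_smul map_neg

variable {H : Type*} [NormedAddCommGroup H] [InnerProductSpace ℂ H] [CompleteSpace H]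

/-! ### Elementary properties of spectral measures -/

section Basic

variable (E : SpectralMeasure H) {s t : Set ℝ}

theorem isSelfAdjoint_proj (s : Set ℝ) : IsSelfAdjoint (E.proj s) := by
  by_cases hs : MeasurableSet s
  · exact (E.isStarProjection s hs).isSelfAdjoint
  · rw [E.not_measurable s hs]
    exact .zero _

theorem proj_proj_self (hs : MeasurableSet s) (x : H) : E.proj s (E.proj s x) = E.proj s x :=
  congrArg (fun T : H →L[ℂ] H => T x) (E.isStarProjection s hs).isIdempotentElem.eq

theorem inner_proj (hs : MeasurableSet s) (x : H) :
    inner ℂ x (E.proj s x) = ((‖E.proj s x‖ ^ 2 : ℝ) : ℂ) := by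
  rw [← E.proj_proj_self hs, ← (E.isSelfAdjoint_proj s).inner_apply_left,
    E.proj_proj_self hs, inner_self_eq_norm_sq_to_K]
  norm_cast

theorem scalarMeasure_eq_norm_sq (hs : MeasurableSet s) (x : H) :
    E.scalarMeasure x s = ENNReal.ofReal (‖E.proj s x‖ ^ 2) := by
  rw [E.scalarMeasure_apply x hs, E.inner_proj hs, Complex.ofReal_re]

instance (x : H) : IsFiniteMeasure (E.scalarMeasure x) :=
  ⟨by rw [E.scalarMeasure_eq_norm_sq .univ]; exact ENNReal.ofReal_lt_top⟩

theorem scalarMeasure_real (hs : MeasurableSet s) (x : H) :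
    (E.scalarMeasure x).real s = ‖E.proj s x‖ ^ 2 := by
  rw [Measure.real, E.scalarMeasure_eq_norm_sq hs, ENNReal.toReal_ofReal (sq_nonneg _)]

theorem scalarMeasure_real_univ (x : H) : (E.scalarMeasure x).real Set.univ = ‖x‖ ^ 2 := by
  rw [E.scalarMeasure_real .univ, E.univ]; rfl

theorem scalarMeasure_eq_zero_iff (hs : MeasurableSet s) (x : H) :
    E.scalarMeasure x s = 0 ↔ E.proj s x = 0 := by
  rw [E.scalarMeasure_eq_norm_sq hs, ENNReal.ofReal_eq_zero]
  constructor
  · intro h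
    exact norm_eq_zero.1 (pow_eq_zero_iff two_ne_zero |>.1 (le_antisymm h (sq_nonneg _)))
  · intro h
    simp [h]

theorem proj_union (hs : MeasurableSet s) (ht : MeasurableSet t) (hd : Disjoint s t) :
    E.proj (s ∪ t) = E.proj s + E.proj t := by
  refine ContinuousLinearMap.coe_injective ((ext_inner_map _ _).1 fun x => ?_)
  have h := measureReal_union (μ := E.scalarMeasure x) hd ht
  rw [E.scalarMeasure_real (hs.union ht), E.scalarMeasure_real hs, E.scalarMeasure_real ht] at h
  change inner ℂ (E.proj (s ∪ t) x) x = inner ℂ (E.proj s x + E.proj t x) x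
  rw [inner_add_left, (E.isSelfAdjoint_proj _).inner_apply_left,
    (E.isSelfAdjoint_proj _).inner_apply_left, (E.isSelfAdjoint_proj _).inner_apply_left,
    E.inner_proj (hs.union ht), E.inner_proj hs, E.inner_proj ht, h]
  push_cast
  ring

theorem proj_add_proj_compl (hs : MeasurableSet s) (x : H) :
    E.proj s x + E.proj sᶜ x = x := by
  have h := E.proj_union hs hs.compl disjoint_compl_right
  rw [Set.union_compl_self, E.univ] at h
  exact (congrArg (fun T : H →L[ℂ] H => T x) h).symm

theorem proj_proj_of_disjoint (hs : MeasurableSet s) (ht : MeasurableSet t) (hd : Disjoint s t)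
    (x : H) : E.proj s (E.proj t x) = 0 := by
  rw [← E.scalarMeasure_eq_zero_iff hs]
  refine measure_mono_null hd.subset_compl_right ?_
  rw [E.scalarMeasure_eq_zero_iff ht.compl]
  have h := E.proj_add_proj_compl ht (E.proj t x)
  rwa [E.proj_proj_self ht, add_eq_left] at h

theorem proj_proj (hs : MeasurableSet s) (ht : MeasurableSet t) (x : H) :
    E.proj s (E.proj t x) = E.proj (s ∩ t) x := by
  have hst := hs.inter ht
  have h1 := E.proj_union hst (hs.diff ht) (Set.disjoint_sdiff_inter.symm)
  have h2 := E.proj_union hst (ht.diff hs) (Set.inter_comm s t ▸ Set.disjoint_sdiff_inter.symm)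
  rw [Set.inter_union_sdiff] at h1
  rw [Set.inter_comm s t, Set.inter_union_sdiff, Set.inter_comm t s] at h2
  rw [h1, _root_.add_apply,
    E.proj_proj_of_disjoint (hs.diff ht) ht Set.disjoint_sdiff_left, add_zero, h2,
    _root_.add_apply, map_add, E.proj_proj_self hst,
    E.proj_proj_of_disjoint hst (ht.diff hs), add_zero]
  exact Set.disjoint_left.2 fun a ha hb => hb.2 ha.1

theorem commute_proj_proj (hs : MeasurableSet s) (ht : MeasurableSet t) :
    Commute (E.proj s) (E.proj t) := by
  ext x
  change E.proj s (E.proj t x) = E.proj t (E.proj s x)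
  rw [E.proj_proj hs ht, E.proj_proj ht hs, Set.inter_comm]

/-- The measure `⟨E(·) x, x⟩` of a vector in the range of `E(s)` is concentrated on `s`. -/
theorem ae_mem_of_proj_eq (hs : MeasurableSet s) {x : H} (hx : E.proj s x = x) :
    ∀ᵐ t ∂E.scalarMeasure x, t ∈ s := by
  refine (E.scalarMeasure_eq_zero_iff hs.compl x).2 ?_
  have h := E.proj_add_proj_compl hs x
  rwa [hx, add_eq_left] at h

end Basic

/-! ### Bounded operators commuting with a spectral measure -/

section Commutant

variable {E : SpectralMeasure H} {R : H →ₗ.[ℂ] H}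

theorem IsSpectralMeasureOf.integral_eq (hE : E.IsSpectralMeasureOf R) {x y : H}
    (h : (x, y) ∈ R.graph) : ∫ t : ℝ, t ∂E.scalarMeasure x = (inner ℂ x y).re := by
  obtain ⟨u, hu, hy⟩ := (mem_graph_iff _).1 h
  simp only at hu hy
  rw [← hu, ← hy, hE.2 u, Complex.ofReal_re]

theorem IsSpectralMeasureOf.integrable (hE : E.IsSpectralMeasureOf R) {x : H}
    (h : x ∈ R.domain) : Integrable (fun t : ℝ => t) (E.scalarMeasure x) := by
  refine Integrable.mono' ((integrable_const (1 : ℝ)).add ((hE.1 x).1 h))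
    measurable_id.aestronglyMeasurable (.of_forall fun t => ?_)
  rw [Real.norm_eq_abs, Pi.add_apply]
  nlinarith [sq_abs t, sq_nonneg (|t| - 1), abs_nonneg t]

theorem adjoint_proj_comm {S : H →L[ℂ] H} (hS : ∀ s, MeasurableSet s → Commute S (E.proj s))
    {s : Set ℝ} (hs : MeasurableSet s) (x : H) :
    E.proj s (ContinuousLinearMap.adjoint S x) = ContinuousLinearMap.adjoint S (E.proj s x) := by
  refine ext_inner_left ℂ fun k => ?_
  rw [ContinuousLinearMap.adjoint_inner_right, ← (E.isSelfAdjoint_proj s).inner_apply_left,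
    ← (E.isSelfAdjoint_proj s).inner_apply_left, ContinuousLinearMap.adjoint_inner_right]
  exact congrArg (fun T : H →L[ℂ] H => inner ℂ (T k) x) (hS s hs).eq

theorem scalarMeasure_apply_le {S : H →L[ℂ] H}
    (hS : ∀ s, MeasurableSet s → ∀ x, E.proj s (S x) = S (E.proj s x)) (x : H) :
    E.scalarMeasure (S x) ≤ ENNReal.ofReal (‖S‖ ^ 2) • E.scalarMeasure x := by
  refine Measure.le_iff.2 fun s hs => ?_
  rw [Measure.smul_apply, smul_eq_mul, E.scalarMeasure_eq_norm_sq hs,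
    E.scalarMeasure_eq_norm_sq hs, ← ENNReal.ofReal_mul (sq_nonneg _), hS s hs, ← mul_pow]
  gcongr
  exact S.le_opNorm _

theorem IsSpectralMeasureOf.apply_mem_domain (hE : E.IsSpectralMeasureOf R) {S : H →L[ℂ] H}
    (hS : ∀ s, MeasurableSet s → ∀ x, E.proj s (S x) = S (E.proj s x)) {x : H}
    (hx : x ∈ R.domain) : S x ∈ R.domain :=
  (hE.1 _).2 ((((hE.1 x).1 hx).smul_measure ENNReal.ofReal_ne_top).mono_measure
    (scalarMeasure_apply_le hS x))

/-- The polarized form of the commutation of `S` with `E`, as an identity of positive measures. -/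
theorem scalarMeasure_add_eq {S : H →L[ℂ] H}
    (hS : ∀ s, MeasurableSet s → Commute S (E.proj s)) (x y : H) :
    E.scalarMeasure (S x + y) + E.scalarMeasure (x - ContinuousLinearMap.adjoint S y) =
      E.scalarMeasure (x + ContinuousLinearMap.adjoint S y) + E.scalarMeasure (S x - y) := by
  refine Measure.ext fun s hs => ?_
  have hre : ∀ a b : H, (inner ℂ a (E.proj s b)).re = (inner ℂ b (E.proj s a)).re := by
    intro a b
    rw [← (E.isSelfAdjoint_proj s).inner_apply_left, ← inner_conj_symm, Complex.conj_re]
  have hc : (inner ℂ y (E.proj s (S x))).re =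
      (inner ℂ (ContinuousLinearMap.adjoint S y) (E.proj s x)).re := by
    rw [ContinuousLinearMap.adjoint_inner_left]
    exact congrArg (fun T : H →L[ℂ] H => (inner ℂ y (T x)).re) (hS s hs).eq.symm
  simp only [Measure.add_apply, E.scalarMeasure_apply _ hs]
  rw [← ENNReal.ofReal_add (E.inner_proj_nonneg hs _) (E.inner_proj_nonneg hs _),
    ← ENNReal.ofReal_add (E.inner_proj_nonneg hs _) (E.inner_proj_nonneg hs _)]
  congr 1
  simp only [map_add, map_sub, inner_add_left, inner_add_right, inner_sub_left, inner_sub_right,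
    Complex.add_re, Complex.sub_re]
  rw [hre (S x) y, hre x (ContinuousLinearMap.adjoint S y), hc]
  ring

/-- A bounded operator that commutes with the spectral measure of `R` commutes with `R`. -/
theorem IsSpectralMeasureOf.apply_mem_graph (hE : E.IsSpectralMeasureOf R) (hR : IsSelfAdjoint R)
    {S : H →L[ℂ] H} (hS : ∀ s, MeasurableSet s → Commute S (E.proj s)) {x x' : H}
    (hx : (x, x') ∈ R.graph) : (S x, S x') ∈ R.graph := by
  have hd := hR.dense_domain
  have hsym : ∀ {a a' b b' : H}, (a, a') ∈ R.graph → (b, b') ∈ R.graph →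
      inner ℂ a' b = inner ℂ a b' := by
    intro a a' b b' ha hb
    rw [← isSelfAdjoint_def.1 hR] at ha
    exact (mem_graph_adjoint hd).1 ha _ _ hb
  have hS' : ∀ s, MeasurableSet s → ∀ x, E.proj s (S x) = S (E.proj s x) := fun s hs x =>
    congrArg (fun T : H →L[ℂ] H => T x) (hS s hs).eq.symm
  obtain ⟨u, hu⟩ := mem_domain_iff.1 (hE.apply_mem_domain hS' (mem_domain_of_mem_graph hx))
  suffices h : ∀ y, (inner ℂ y (u - S x')).re = 0 by
    have h1 : u - S x' = 0 := norm_eq_zero.1 ((pow_eq_zero_iff two_ne_zero).1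
      ((inner_self_eq_norm_sq (𝕜 := ℂ) _).symm.trans (h _)))
    rwa [← sub_eq_zero.1 h1]
  refine fun y => hd.induction (P := fun y => (inner ℂ y (u - S x')).re = 0) (fun y hy => ?_)
    (isClosed_eq (by fun_prop) continuous_const) y
  obtain ⟨y', hy'⟩ := mem_domain_iff.1 hy
  obtain ⟨v, hv⟩ := mem_domain_iff.1
    (hE.apply_mem_domain (S := ContinuousLinearMap.adjoint S) (fun s hs => adjoint_proj_comm hS hs)
      hy)
  have hi : ∀ {a a' : H}, (a, a') ∈ R.graph → Integrable (fun t : ℝ => t) (E.scalarMeasure a) :=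
    fun h => hE.integrable (mem_domain_of_mem_graph h)
  have g1 := R.graph.add_mem hu hy'
  have g2 := R.graph.sub_mem hx hv
  have g3 := R.graph.add_mem hx hv
  have g4 := R.graph.sub_mem hu hy'
  have h := congrArg (fun μ : Measure ℝ => ∫ t : ℝ, t ∂μ) (scalarMeasure_add_eq hS x y)
  rw [integral_add_measure (hi g1) (hi g2), integral_add_measure (hi g3) (hi g4),
    hE.integral_eq g1, hE.integral_eq g2, hE.integral_eq g3, hE.integral_eq g4] at h
  simp only [inner_add_left, inner_add_right, inner_sub_left, inner_sub_right,
    Complex.add_re, Complex.sub_re] at h ⊢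
  have e1 : (inner ℂ (S x) y').re = (inner ℂ y u).re := by
    rw [← hsym hu hy', ← inner_conj_symm, Complex.conj_re]
  have e2 : (inner ℂ x v).re = (inner ℂ y (S x')).re := by
    rw [← hsym hx hv, ContinuousLinearMap.adjoint_inner_right, ← inner_conj_symm, Complex.conj_re]
  have e3 : (inner ℂ (ContinuousLinearMap.adjoint S y) x').re = (inner ℂ y (S x')).re := by
    rw [ContinuousLinearMap.adjoint_inner_left]
  rw [e1, e2, e3] at h
  linarith

theorem IsSpectralMeasureOf.proj_mem_graph (hE : E.IsSpectralMeasureOf R) (hR : IsSelfAdjoint R)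
    {s : Set ℝ} (hs : MeasurableSet s) {x x' : H} (hx : (x, x') ∈ R.graph) :
    (E.proj s x, E.proj s x') ∈ R.graph :=
  hE.apply_mem_graph hR (fun _ ht => E.commute_proj_proj hs ht) hx

/-- A bounded operator that commutes with the spectral measure of `R` commutes with
`(I + R²)⁻¹`. -/
theorem IsSpectralMeasureOf.commute_resolvent (hE : E.IsSpectralMeasureOf R)
    (hR : IsSelfAdjoint R) {T : H →L[ℂ] H}
    (hT : ∀ x y, (x, y) ∈ (R ∘ₚ R).graph ↔ T (x + y) = x)
    {S : H →L[ℂ] H} (hS : ∀ s, MeasurableSet s → Commute S (E.proj s)) : Commute S T := by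
  ext x
  obtain ⟨b, hb1, hb2⟩ := mem_graph_pcomp.1
    ((hT (T x) (x - T x)).2 (by rw [add_sub_cancel]))
  have h := (hT _ _).1 (mem_graph_pcomp.2
    ⟨S b, hE.apply_mem_graph hR hS hb1, hE.apply_mem_graph hR hS hb2⟩)
  rw [← map_add, add_sub_cancel] at h
  exact h.symm

end Commutant

end SpectralMeasure

namespace SpectralMeasure

open MeasureTheory Filter Topology
open LinearPMap hiding map_add map_sub map_zero map_smul map_neg

variable {H : Type*} [NormedAddCommGroup H] [InnerProductSpace ℂ H] [CompleteSpace H]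

/-! ### Spectral subspaces of a positive selfadjoint operator -/

section SpectralSubspace

variable {E : SpectralMeasure H} {R : H →ₗ.[ℂ] H}

theorem IsSpectralMeasureOf.inner_le (hE : E.IsSpectralMeasureOf R) {a : ℝ} {x x' : H}
    (hx : (x, x') ∈ R.graph) (ha : E.proj (Set.Iic a) x = x) :
    (inner ℂ x x').re ≤ a * ‖x‖ ^ 2 := by
  rw [← hE.integral_eq hx, ← E.scalarMeasure_real_univ, mul_comm, ← smul_eq_mul,
    ← integral_const]
  exact integral_mono_ae (hE.integrable (mem_domain_of_mem_graph hx)) (integrable_const a)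
    (E.ae_mem_of_proj_eq measurableSet_Iic ha)

theorem IsSpectralMeasureOf.le_inner (hE : E.IsSpectralMeasureOf R) {b : ℝ} {x x' : H}
    (hx : (x, x') ∈ R.graph) (hb : E.proj (Set.Ioi b) x = x) :
    b * ‖x‖ ^ 2 ≤ (inner ℂ x x').re := by
  rw [← hE.integral_eq hx, ← E.scalarMeasure_real_univ, mul_comm, ← smul_eq_mul,
    ← integral_const]
  refine integral_mono_ae (integrable_const b) (hE.integrable (mem_domain_of_mem_graph hx)) ?_
  filter_upwards [E.ae_mem_of_proj_eq measurableSet_Ioi hb] with t ht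
  exact le_of_lt ht

theorem IsSpectralMeasureOf.proj_Iio_zero (hE : E.IsSpectralMeasureOf R)
    (hR : R.IsPositiveSelfAdjoint) : E.proj (Set.Iio 0) = 0 := by
  ext x
  refine hR.1.dense_domain.induction (P := fun x => E.proj (Set.Iio 0) x = (0 : H →L[ℂ] H) x)
    (fun x hx => ?_) (isClosed_eq (by fun_prop) (by fun_prop)) x
  obtain ⟨x', hx'⟩ := mem_domain_iff.1 hx
  have h1 := hE.proj_mem_graph hR.1 measurableSet_Iio hx' (s := Set.Iio 0)
  set z := E.proj (Set.Iio 0) x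
  have h2 := E.ae_mem_of_proj_eq measurableSet_Iio (E.proj_proj_self measurableSet_Iio x)
    (s := Set.Iio (0 : ℝ))
  change ∀ᵐ t ∂E.scalarMeasure z, t ∈ Set.Iio (0 : ℝ) at h2
  have hi := hE.integrable (mem_domain_of_mem_graph h1)
  have h3 := hR.inner_nonneg h1
  rw [← hE.integral_eq h1] at h3
  have hn : 0 ≤ᵐ[E.scalarMeasure z] fun t : ℝ => -t := by
    filter_upwards [h2] with t ht
    exact neg_nonneg.2 (le_of_lt ht)
  have h4 : ∫ t : ℝ, -t ∂E.scalarMeasure z = 0 := by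
    refine le_antisymm ?_ (integral_nonneg_of_ae hn)
    rw [integral_neg]
    linarith
  have hi' : Integrable (fun t : ℝ => -t) (E.scalarMeasure z) := hi.neg
  have h5 : E.scalarMeasure z Set.univ = 0 := by
    refine measure_mono_null (fun t _ => ?_) (measure_union_null h2
      ((integral_eq_zero_iff_of_nonneg_ae hn hi').1 h4))
    by_cases ht : t ∈ Set.Iio (0 : ℝ)
    · exact Or.inr fun h => (ne_of_lt ht) (neg_eq_zero.1 h)
    · exact Or.inl fun h => ht h
  rw [E.scalarMeasure_eq_zero_iff .univ, E.univ] at h5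
  exact h5

/-- On the range of `E((-∞, a])` the operator `R` is everywhere defined and bounded by `a`. The
bound is extracted from `0 ≤ R ≤ a` through
`a R (a - R) = R (a - R) R + (a - R) R (a - R) ≥ 0`. -/
theorem IsSpectralMeasureOf.exists_mem_graph_of_proj_Iic (hE : E.IsSpectralMeasureOf R)
    (hR : R.IsPositiveSelfAdjoint) {a : ℝ} (ha : 0 < a) {x : H}
    (hx : E.proj (Set.Iic a) x = x) :
    ∃ x', (x, x') ∈ R.graph ∧ E.proj (Set.Iic a) x' = x' ∧ ‖x'‖ ≤ a * ‖x‖ := by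
  have hex : ∀ x, E.proj (Set.Iic a) x = x →
      ∃ x', (x, x') ∈ R.graph ∧ E.proj (Set.Iic a) x' = x' := by
    intro x hx
    have h1 : x ∈ R.domain := by
      refine (hE.1 x).2 ((integrable_const (a ^ 2)).mono' (by fun_prop) ?_)
      have h0 : ∀ᵐ t ∂E.scalarMeasure x, 0 ≤ t := by
        have : E.scalarMeasure x (Set.Iio 0) = 0 := by
          rw [E.scalarMeasure_eq_zero_iff measurableSet_Iio, hE.proj_Iio_zero hR]; rfl
        filter_upwards [measure_eq_zero_iff_ae_notMem.1 this] with t ht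
        exact not_lt.1 ht
      filter_upwards [h0, E.ae_mem_of_proj_eq measurableSet_Iic hx] with t ht ht'
      rw [Real.norm_of_nonneg (sq_nonneg t)]
      exact pow_le_pow_left₀ ht ht' 2
    obtain ⟨x', hx'⟩ := mem_domain_iff.1 h1
    have h2 := hE.proj_mem_graph hR.1 measurableSet_Iic hx' (s := Set.Iic a)
    rw [hx] at h2
    exact ⟨x', hx', mem_graph_snd_inj _ h2 hx' rfl⟩
  obtain ⟨x', hx', hp'⟩ := hex x hx
  obtain ⟨x'', hx'', -⟩ := hex x' hp'
  refine ⟨x', hx', hp', ?_⟩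
  have h1 := hE.inner_le hx' hx
  have h2 := hE.inner_le hx'' hp'
  have h3 := hR.inner_nonneg
    (R.graph.sub_mem (R.graph.smul_mem (a : ℂ) hx') hx'')
  have h4 : inner ℂ x x'' = inner ℂ x' x' := by
    have hx2 := hx'
    rw [← isSelfAdjoint_def.1 hR.1] at hx2
    exact ((mem_graph_adjoint hR.1.dense_domain).1 hx2 _ _ hx'').symm
  have h5 : (inner ℂ x' x').re = ‖x'‖ ^ 2 := inner_self_eq_norm_sq (𝕜 := ℂ) x'
  change 0 ≤ (inner ℂ ((a : ℂ) • x - x') ((a : ℂ) • x' - x'')).re at h3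
  simp only [inner_sub_left, inner_sub_right, inner_smul_left, inner_smul_right, Complex.sub_re,
    Complex.conj_ofReal, Complex.re_ofReal_mul, h4, h5] at h3
  have h6 : ‖x'‖ ^ 2 ≤ a * (inner ℂ x x').re := by
    refine le_of_mul_le_mul_left (a := a) ?_ ha
    linarith
  exact abs_le_of_sq_le_sq' (by nlinarith) (by positivity) |>.2

variable {T : H →L[ℂ] H}

/-- On the range of `E((-∞, a])` the operator `(I + R²)⁻¹` has an inverse bounded by `1 + a²`. -/
theorem IsSpectralMeasureOf.exists_resolvent_apply_eq (hE : E.IsSpectralMeasureOf R)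
    (hR : R.IsPositiveSelfAdjoint)
    (hT : ∀ x y, (x, y) ∈ (R ∘ₚ R).graph ↔ T (x + y) = x) {a : ℝ} (ha : 0 < a) {x : H}
    (hx : E.proj (Set.Iic a) x = x) :
    ∃ y, E.proj (Set.Iic a) y = y ∧ T y = x ∧ ‖y‖ ≤ (1 + a ^ 2) * ‖x‖ := by
  obtain ⟨x', h1, h2, h3⟩ := hE.exists_mem_graph_of_proj_Iic hR ha hx
  obtain ⟨x'', h4, h5, h6⟩ := hE.exists_mem_graph_of_proj_Iic hR ha h2
  refine ⟨x + x'', by rw [map_add, hx, h5], (hT _ _).1 (mem_graph_pcomp.2 ⟨_, h1, h4⟩), ?_⟩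
  calc ‖x + x''‖ ≤ ‖x‖ + a * (a * ‖x‖) := by
        refine (norm_add_le _ _).trans ?_
        gcongr
        exact h6.trans (by gcongr)
    _ = _ := by ring

/-- On the range of `E((b, ∞))` the operator `(I + R²)⁻¹` is bounded by `1 / (1 + b²)`. -/
theorem IsSpectralMeasureOf.norm_resolvent_apply_le (hE : E.IsSpectralMeasureOf R)
    (hR : R.IsPositiveSelfAdjoint)
    (hT : ∀ x y, (x, y) ∈ (R ∘ₚ R).graph ↔ T (x + y) = x) {b : ℝ} (hb : 0 < b) {z : H}
    (hz : E.proj (Set.Ioi b) z = z) :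
    E.proj (Set.Ioi b) (T z) = T z ∧ (1 + b ^ 2) * ‖T z‖ ≤ ‖z‖ := by
  have hc : E.proj (Set.Ioi b) (T z) = T z := by
    have h := hE.commute_resolvent hR.1 hT
      (fun s hs => E.commute_proj_proj (measurableSet_Ioi (a := b)) hs)
    have h1 := congrArg (fun T : H →L[ℂ] H => T z) h.eq
    change E.proj (Set.Ioi b) (T z) = T (E.proj (Set.Ioi b) z) at h1
    rw [h1, hz]
  refine ⟨hc, ?_⟩
  obtain ⟨w', h1, h2⟩ := mem_graph_pcomp.1 ((hT (T z) (z - T z)).2 (by rw [add_sub_cancel]))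
  set w := T z
  have h3 : b * ‖w‖ ^ 2 ≤ ‖w‖ * ‖w'‖ :=
    (hE.le_inner h1 hc).trans (re_inner_le_norm (𝕜 := ℂ) w w')
  have h4 : inner ℂ w (z - w) = inner ℂ w' w' := by
    have hx2 := h1
    rw [← isSelfAdjoint_def.1 hR.1] at hx2
    exact ((mem_graph_adjoint hR.1.dense_domain).1 hx2 _ _ h2).symm
  have h5 : ‖w‖ ^ 2 + ‖w'‖ ^ 2 ≤ ‖w‖ * ‖z‖ := by
    have h6 : (inner ℂ w z).re = ‖w‖ ^ 2 + ‖w'‖ ^ 2 := by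
      rw [inner_sub_right, sub_eq_iff_eq_add] at h4
      rw [h4, Complex.add_re, add_comm]
      exact congrArg₂ (· + ·) (inner_self_eq_norm_sq (𝕜 := ℂ) w)
        (inner_self_eq_norm_sq (𝕜 := ℂ) w')
    rw [← h6]
    exact re_inner_le_norm (𝕜 := ℂ) w z
  rcases (norm_nonneg w).eq_or_lt with h0 | h0
  · rw [← h0, mul_zero]
    exact norm_nonneg z
  · have h7 : b * ‖w‖ ≤ ‖w'‖ := le_of_mul_le_mul_left (by linarith) h0
    have h8 : (b * ‖w‖) ^ 2 ≤ ‖w'‖ ^ 2 := pow_le_pow_left₀ (by positivity) h7 2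
    refine le_of_mul_le_mul_left ?_ h0
    nlinarith

/-- The growth of the powers of `T = (I + R²)⁻¹` separates the spectral subspaces: for `S`
commuting with `T`, `E((b, ∞)) S E((-∞, a])` equals `Tⁿ E((b, ∞)) S T⁻ⁿ E((-∞, a])`, whose norm is
at most a constant times `((1 + a²) / (1 + b²))ⁿ`. -/
theorem IsSpectralMeasureOf.proj_Ioi_apply_eq_zero_of_lt (hE : E.IsSpectralMeasureOf R)
    (hR : R.IsPositiveSelfAdjoint)
    (hT : ∀ x y, (x, y) ∈ (R ∘ₚ R).graph ↔ T (x + y) = x)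
    {S : H →L[ℂ] H} (hS : Commute S T) {a b : ℝ} (ha : 0 < a) (hab : a < b) {x : H}
    (hx : E.proj (Set.Iic a) x = x) : E.proj (Set.Ioi b) (S x) = 0 := by
  have hb := ha.trans hab
  have hcT : Commute (E.proj (Set.Ioi b)) T := hE.commute_resolvent hR.1 hT
      (fun s hs => E.commute_proj_proj (measurableSet_Ioi (a := b)) hs)
  have h1 : ∀ n : ℕ, ∃ y, E.proj (Set.Iic a) y = y ∧ (T ^ n) y = x ∧
      ‖y‖ ≤ (1 + a ^ 2) ^ n * ‖x‖ := by
    intro n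
    induction n with
    | zero => exact ⟨x, hx, rfl, by simp⟩
    | succ n ih =>
      obtain ⟨y, hy1, hy2, hy3⟩ := ih
      obtain ⟨w, hw1, hw2, hw3⟩ := hE.exists_resolvent_apply_eq hR hT ha hy1
      refine ⟨w, hw1, by rw [pow_succ, mul_apply_eq_comp, hw2, hy2], hw3.trans ?_⟩
      calc (1 + a ^ 2) * ‖y‖ ≤ (1 + a ^ 2) * ((1 + a ^ 2) ^ n * ‖x‖) := by gcongr
        _ = _ := by ring
  have h2 : ∀ (n : ℕ) (z : H), E.proj (Set.Ioi b) z = z →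
      (1 + b ^ 2) ^ n * ‖(T ^ n) z‖ ≤ ‖z‖ := by
    intro n
    induction n with
    | zero => intro z _; simp
    | succ n ih =>
      intro z hz
      obtain ⟨h3, h4⟩ := hE.norm_resolvent_apply_le hR hT hb hz
      rw [pow_succ T, mul_apply_eq_comp]
      calc _ = (1 + b ^ 2) * ((1 + b ^ 2) ^ n * ‖(T ^ n) (T z)‖) := by ring
        _ ≤ (1 + b ^ 2) * ‖T z‖ := by gcongr; exact ih _ h3
        _ ≤ _ := h4
  have h3 : ∀ n : ℕ, ‖E.proj (Set.Ioi b) (S x)‖ ≤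
      ((1 + a ^ 2) / (1 + b ^ 2)) ^ n * (‖E.proj (Set.Ioi b)‖ * ‖S‖ * ‖x‖) := by
    intro n
    obtain ⟨y, -, hy2, hy3⟩ := h1 n
    have h4 : E.proj (Set.Ioi b) (S x) = (T ^ n) (E.proj (Set.Ioi b) (S y)) := by
      rw [← hy2]
      exact congrArg (fun T : H →L[ℂ] H => T y) ((hcT.mul_left hS).pow_right n).eq
    have h5 := h2 n _ (E.proj_proj_self (measurableSet_Ioi (a := b)) (S y))
    rw [← h4] at h5
    rw [div_pow, div_mul_eq_mul_div, le_div_iff₀ (by positivity), mul_comm]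
    calc _ ≤ ‖E.proj (Set.Ioi b) (S y)‖ := h5
      _ ≤ ‖E.proj (Set.Ioi b)‖ * (‖S‖ * ((1 + a ^ 2) ^ n * ‖x‖)) := by
          refine (ContinuousLinearMap.le_opNorm _ _).trans ?_
          gcongr
          refine (ContinuousLinearMap.le_opNorm _ _).trans ?_
          gcongr
      _ = _ := by ring
  have h4 : Tendsto (fun n : ℕ => ((1 + a ^ 2) / (1 + b ^ 2)) ^ n *
      (‖E.proj (Set.Ioi b)‖ * ‖S‖ * ‖x‖)) atTop (𝓝 0) := by
    rw [← zero_mul (‖E.proj (Set.Ioi b)‖ * ‖S‖ * ‖x‖)]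
    refine (tendsto_pow_atTop_nhds_zero_of_lt_one (by positivity) ?_).mul_const _
    rw [div_lt_one (by positivity)]
    nlinarith
  exact norm_le_zero_iff.1 (ge_of_tendsto' h4 h3)

theorem IsSpectralMeasureOf.proj_Ioi_apply_eq_zero (hE : E.IsSpectralMeasureOf R)
    (hR : R.IsPositiveSelfAdjoint)
    (hT : ∀ x y, (x, y) ∈ (R ∘ₚ R).graph ↔ T (x + y) = x)
    {S : H →L[ℂ] H} (hS : Commute S T) {c : ℝ} {x : H}
    (hx : E.proj (Set.Iic c) x = x) : E.proj (Set.Ioi c) (S x) = 0 := by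
  rcases lt_or_ge c 0 with hc | hc
  · have h1 : x = 0 := by
      rw [← hx, ← Set.inter_eq_self_of_subset_right (Set.Iic_subset_Iio.2 hc),
        ← E.proj_proj measurableSet_Iio measurableSet_Iic, hE.proj_Iio_zero hR]
      rfl
    rw [h1, map_zero, map_zero]
  · have h1 : Set.Ioi c = ⋃ n : ℕ, Set.Ioi (c + 1 / ((n : ℝ) + 1)) := by
      ext t
      simp only [Set.mem_Ioi, Set.mem_iUnion]
      constructor
      · intro ht
        obtain ⟨n, hn⟩ := exists_nat_one_div_lt (sub_pos.2 ht)
        exact ⟨n, by linarith⟩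
      · rintro ⟨n, hn⟩
        have : 0 < 1 / ((n : ℝ) + 1) := by positivity
        linarith
    rw [← E.scalarMeasure_eq_zero_iff measurableSet_Ioi, h1]
    refine measure_iUnion_null fun n => ?_
    rw [E.scalarMeasure_eq_zero_iff measurableSet_Ioi]
    have hn : 0 < 1 / ((n : ℝ) + 1) := by positivity
    refine hE.proj_Ioi_apply_eq_zero_of_lt hR hT hS (a := c + 1 / ((n : ℝ) + 1) / 2)
      (by linarith) (by linarith) ?_
    rw [← hx, E.proj_proj measurableSet_Iic measurableSet_Iic,
      Set.inter_eq_self_of_subset_right (Set.Iic_subset_Iic.2 (by linarith))]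

/-- The sets whose projection commutes with a given operator are determined by half-lines. -/
theorem commute_proj_of_Iic {S : H →L[ℂ] H} (h : ∀ c : ℝ, Commute S (E.proj (Set.Iic c)))
    {s : Set ℝ} (hs : MeasurableSet s) : Commute S (E.proj s) := by
  induction s, hs using MeasurableSpace.induction_on_inter
    (borel_eq_generateFrom_Iic ℝ ▸ BorelSpace.measurable_eq) isPiSystem_Iic with
  | empty => rw [E.empty]; exact Commute.zero_right S
  | basic t ht =>
    obtain ⟨c, rfl⟩ := ht
    exact h c
  | compl t ht ih =>
    have h1 : E.proj tᶜ = 1 - E.proj t := by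
      ext x
      exact eq_sub_of_add_eq' (E.proj_add_proj_compl ht x)
    rw [h1]
    exact (Commute.one_right S).sub_right ih
  | iUnion f hd hf ih =>
    ext x
    refine HasSum.unique (f := fun i => S (E.proj (f i) x))
      ((E.hasSum_iUnion f hf hd x).mapL S) ?_
    have h1 : ∀ i, S (E.proj (f i) x) = E.proj (f i) (S x) :=
      fun i => congrArg (fun T : H →L[ℂ] H => T x) (ih i).eq
    simp only [h1]
    exact E.hasSum_iUnion f hf hd (S x)

/-- A bounded operator that commutes with `(I + R²)⁻¹` commutes with the spectral measure
of `R`. -/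
theorem IsSpectralMeasureOf.commute_proj (hE : E.IsSpectralMeasureOf R)
    (hR : R.IsPositiveSelfAdjoint)
    (hT : ∀ x y, (x, y) ∈ (R ∘ₚ R).graph ↔ T (x + y) = x) (hTs : IsSelfAdjoint T)
    {S : H →L[ℂ] H} (hS : Commute S T) {s : Set ℝ} (hs : MeasurableSet s) :
    Commute S (E.proj s) := by
  refine commute_proj_of_Iic (fun c => ?_) hs
  have hS' : Commute (star S) T := by
    have := hS.star_star
    rwa [hTs.star_eq] at this
  -- `Q S P = 0` for `P = E((-∞, c])` and `Q = I - P`, and `P S Q = (Q S* P)* = 0`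
  have h1 : ∀ x, E.proj (Set.Ioi c) (S (E.proj (Set.Iic c) x)) = 0 := fun x =>
    hE.proj_Ioi_apply_eq_zero hR hT hS (E.proj_proj_self measurableSet_Iic x)
  have h2 : ∀ x, E.proj (Set.Iic c) (S (E.proj (Set.Ioi c) x)) = 0 := by
    intro x
    refine ext_inner_left ℂ fun y => ?_
    rw [← (E.isSelfAdjoint_proj _).inner_apply_left, ← ContinuousLinearMap.adjoint_inner_left,
      ← (E.isSelfAdjoint_proj _).inner_apply_left, inner_zero_right]
    have h3 := hE.proj_Ioi_apply_eq_zero hR hT hS' (E.proj_proj_self measurableSet_Iic y)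
      (c := c)
    rw [ContinuousLinearMap.star_eq_adjoint] at h3
    rw [h3, inner_zero_left]
  have h3 : ∀ x, E.proj (Set.Iic c) x + E.proj (Set.Ioi c) x = x := by
    intro x
    have := E.proj_add_proj_compl (measurableSet_Iic (a := c)) x
    rwa [Set.compl_Iic] at this
  ext x
  change S (E.proj (Set.Iic c) x) = E.proj (Set.Iic c) (S x)
  have h4 := h3 (S (E.proj (Set.Iic c) x))
  rw [h1, add_zero] at h4
  rw [← h4]
  conv_rhs => rw [← h3 x, map_add, map_add, h2, add_zero]

end SpectralSubspace

end SpectralMeasure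

namespace LinearPMap

variable {H : Type*} [NormedAddCommGroup H] [InnerProductSpace ℂ H] [CompleteSpace H]

/-! ### The resolvent `(I + R)⁻¹` of a positive selfadjoint operator -/

theorem IsPositiveSelfAdjoint.exists_resolvent {R : H →ₗ.[ℂ] H} (hR : R.IsPositiveSelfAdjoint) :
    ∃ K : H →L[ℂ] H, IsSelfAdjoint K ∧ Function.Injective K ∧
      ∀ x y, (x, y) ∈ R.graph ↔ K (x + y) = x := by
  have hpos : ∀ {x y : H}, (x, y) ∈ R.graph → 0 ≤ (inner ℂ x y).re :=
    fun h => hR.inner_nonneg h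
  have hadj : ∀ v u : H, (v, u) ∈ R.graph ↔
      ∀ x y, (x, y) ∈ R.graph → inner ℂ u x = inner ℂ v y := by
    intro v u
    rw [← mem_graph_adjoint hR.1.dense_domain, isSelfAdjoint_def.1 hR.1]
  have hbound : ∀ {x y : H}, (x, y) ∈ R.graph → ‖x‖ ≤ ‖x + y‖ ∧ ‖y‖ ≤ ‖x + y‖ := by
    intro x y hxy
    have h1 := hpos hxy
    have h2 : ‖x + y‖ ^ 2 = ‖x‖ ^ 2 + 2 * (inner ℂ x y).re + ‖y‖ ^ 2 :=
      norm_add_sq (𝕜 := ℂ) x y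
    exact ⟨abs_le_of_sq_le_sq' (by nlinarith [sq_nonneg ‖y‖]) (norm_nonneg _) |>.2,
      abs_le_of_sq_le_sq' (by nlinarith [sq_nonneg ‖x‖]) (norm_nonneg _) |>.2⟩
  have : CompleteSpace R.graph := hR.1.isClosed.completeSpace_coe
  let F : R.graph →L[ℂ] H :=
    (ContinuousLinearMap.fst ℂ H H + ContinuousLinearMap.snd ℂ H H) ∘L R.graph.subtypeL
  have hF : ∀ p : R.graph, F p = p.1.1 + p.1.2 := fun p => rfl
  have hanti : AntilipschitzWith 1 F :=
    AddMonoidHomClass.antilipschitz_of_bound F fun p => by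
      rw [NNReal.coe_one, one_mul, hF]
      exact max_le (hbound p.2).1 (hbound p.2).2
  have hclosed : _root_.IsClosed (Set.range F) := hanti.isClosed_range F.uniformContinuous
  have hrange : LinearMap.range (F : R.graph →ₗ[ℂ] H) = ⊤ := by
    have h1 : (LinearMap.range (F : R.graph →ₗ[ℂ] H)).topologicalClosure = ⊤ := by
      rw [Submodule.topologicalClosure_eq_top_iff, Submodule.eq_bot_iff]
      intro y hy
      have h2 : (y, -y) ∈ R.graph := by
        refine (hadj _ _).2 fun a b hab => ?_
        have h3 := Submodule.inner_left_of_mem_orthogonal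
          (LinearMap.mem_range_self (F : R.graph →ₗ[ℂ] H) ⟨_, hab⟩) hy
        change inner ℂ y (a + b) = 0 at h3
        rw [inner_add_right] at h3
        rw [inner_neg_left]
        exact neg_eq_of_add_eq_zero_right h3
      have h3 := hpos h2
      rw [inner_neg_right, Complex.neg_re] at h3
      have h4 : (inner ℂ y y).re = ‖y‖ ^ 2 := inner_self_eq_norm_sq (𝕜 := ℂ) y
      rw [h4] at h3
      exact norm_eq_zero.1 ((pow_eq_zero_iff two_ne_zero).1
        (le_antisymm (by linarith) (sq_nonneg _)))
    rw [← h1]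
    exact (IsClosed.submodule_topologicalClosure_eq (by
      rw [LinearMap.coe_range]
      exact hclosed)).symm
  let e : R.graph ≃L[ℂ] H :=
    ContinuousLinearEquiv.ofBijective F (LinearMap.ker_eq_bot.2 hanti.injective) hrange
  let K : H →L[ℂ] H := (ContinuousLinearMap.fst ℂ H H ∘L R.graph.subtypeL) ∘L e.symm
  have hK1 : ∀ x y, (x, y) ∈ R.graph → K (x + y) = x := by
    intro x y hxy
    have h1 : e ⟨(x, y), hxy⟩ = x + y := rfl
    change (e.symm (x + y)).1.1 = x
    rw [← h1, e.symm_apply_apply]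
  have hK2 : ∀ h, (K h, h - K h) ∈ R.graph := by
    intro h
    have h1 : (e.symm h).1.1 + (e.symm h).1.2 = h := e.apply_symm_apply h
    have h2 : h - K h = (e.symm h).1.2 := sub_eq_of_eq_add' h1.symm
    rw [h2]
    exact (e.symm h).2
  refine ⟨K, ?_, ?_, fun x y => ⟨hK1 x y, fun h => ?_⟩⟩
  · rw [ContinuousLinearMap.isSelfAdjoint_iff_isSymmetric]
    intro h k
    change inner ℂ (K h) k = inner ℂ h (K k)
    have h1 := (hadj _ _).1 (hK2 h) _ _ (hK2 k)
    rw [inner_sub_left, inner_sub_right] at h1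
    linear_combination -h1
  · refine (injective_iff_map_eq_zero K).2 fun h h0 => ?_
    have h1 := hK2 h
    rw [h0, sub_zero] at h1
    exact graph_fst_eq_zero_snd _ h1 rfl
  · have h1 := hK2 (x + y)
    rwa [h, add_sub_cancel_left] at h1

end LinearPMap

namespace SpectralMeasure

open MeasureTheory Filter Topology

variable {H : Type*} [NormedAddCommGroup H] [InnerProductSpace ℂ H] [CompleteSpace H]

/-! ### Spectral measures from families of scalar measures -/

/-- A family of finite measures `ν x` is the family of scalar measures of a spectral measure as soon
as every `ν x s` is given by an operator `P` with `⟨x, P x⟩ = ‖P x‖² = ν x s`. -/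
theorem exists_scalarMeasure_eq (ν : H → Measure ℝ) [∀ x, IsFiniteMeasure (ν x)]
    (huniv : ∀ x, (ν x).real Set.univ = ‖x‖ ^ 2)
    (hP : ∀ s, MeasurableSet s → ∃ P : H →L[ℂ] H, ∀ x,
      inner ℂ x (P x) = (((ν x).real s : ℝ) : ℂ) ∧ ‖P x‖ ^ 2 = (ν x).real s) :
    ∃ E : SpectralMeasure H, ∀ x, E.scalarMeasure x = ν x := by
  classical
  choose! P hP using hP
  have hext : ∀ {A B : H →L[ℂ] H}, (∀ x, inner ℂ x (A x) = inner ℂ x (B x)) → A = B := by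
    intro A B h
    refine ContinuousLinearMap.coe_injective ((ext_inner_map _ _).1 fun x => ?_)
    change inner ℂ (A x) x = inner ℂ (B x) x
    rw [← inner_conj_symm, h, inner_conj_symm]
  have hsa : ∀ s, MeasurableSet s → IsSelfAdjoint (P s) := by
    intro s hs
    refine ContinuousLinearMap.isSelfAdjoint_iff'.2 (hext fun x => ?_)
    rw [ContinuousLinearMap.adjoint_inner_right, ← inner_conj_symm, (hP s hs x).1,
      Complex.conj_ofReal]
  have hunion : ∀ {s t : Set ℝ}, MeasurableSet s → MeasurableSet t → Disjoint s t →
      P (s ∪ t) = P s + P t := by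
    intro s t hs ht hd
    refine hext fun x => ?_
    rw [_root_.add_apply, inner_add_right, (hP _ (hs.union ht) x).1, (hP s hs x).1, (hP t ht x).1,
      measureReal_union hd ht, Complex.ofReal_add]
  have hempty : P ∅ = 0 := hext fun x => by
    rw [(hP ∅ .empty x).1, measureReal_empty]
    simp
  refine ⟨{ proj := fun s => if MeasurableSet s then P s else 0
            isStarProjection := fun s hs => ?_
            not_measurable := fun s hs => if_neg hs
            empty := by rw [if_pos .empty, hempty]
            univ := ?_
            hasSum_iUnion := fun s hs hd x => ?_ }, fun x => Measure.ext fun s hs => ?_⟩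
  · rw [if_pos hs]
    refine ⟨hext fun x => ?_, hsa s hs⟩
    rw [mul_apply_eq_comp, ← (hsa s hs).inner_apply_left, (hP s hs x).1, ← (hP s hs x).2,
      inner_self_eq_norm_sq_to_K]
    norm_cast
  · rw [if_pos .univ]
    refine hext fun x => ?_
    rw [(hP _ .univ x).1, huniv, one_apply_eq_self, inner_self_eq_norm_sq_to_K]
    norm_cast
  · have hU := MeasurableSet.iUnion hs
    simp only [if_pos (hs _), if_pos hU]
    have hF : ∀ F : Finset ℕ, MeasurableSet (⋃ i ∈ F, s i) := fun F =>
      F.measurableSet_biUnion fun i _ => hs i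
    have hsum : ∀ F : Finset ℕ, P (⋃ i ∈ F, s i) = ∑ i ∈ F, P (s i) := by
      intro F
      induction F using Finset.induction_on with
      | empty => simpa using hempty
      | insert i F hi ih =>
        rw [Finset.set_biUnion_insert, Finset.sum_insert hi, ← ih, hunion (hs i) (hF F)]
        exact Set.disjoint_iUnion₂_right.2 fun j hj => hd fun h => hi (h ▸ hj)
    have hnorm : ∀ F : Finset ℕ, ‖∑ i ∈ F, P (s i) x - P (⋃ i, s i) x‖ ^ 2 =
        (ν x).real (⋃ i, s i) - ∑ i ∈ F, (ν x).real (s i) := by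
      intro F
      have hsub : (⋃ i ∈ F, s i) ⊆ ⋃ i, s i := Set.iUnion₂_subset fun i _ => Set.subset_iUnion s i
      have h1 := hunion (hF F) (hU.diff (hF F)) disjoint_sdiff_self_right
      rw [Set.union_sdiff_cancel hsub] at h1
      have h2 : ∑ i ∈ F, P (s i) x = P (⋃ i ∈ F, s i) x := by
        rw [hsum, _root_.sum_apply]
      rw [h2, h1, _root_.add_apply, sub_add_cancel_left, norm_neg, (hP _ (hU.diff (hF F)) x).2,
        measureReal_sdiff hsub (hF F),
        measureReal_biUnion_finset (fun i _ j _ hij => hd hij) (fun i _ => hs i)]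
    have hν : HasSum (fun i => (ν x).real (s i)) ((ν x).real (⋃ i, s i)) := by
      have h1 := measure_iUnion (μ := ν x) hd hs
      rw [Measure.real, h1, ENNReal.tsum_toReal_eq fun i => measure_ne_top _ _]
      exact ENNReal.hasSum_toReal (h1 ▸ measure_ne_top _ _)
    have h3 : Tendsto (fun F : Finset ℕ => ‖∑ i ∈ F, P (s i) x - P (⋃ i, s i) x‖ ^ 2)
        atTop (𝓝 0) := by
      simp only [hnorm]
      rw [← sub_self ((ν x).real (⋃ i, s i))]
      exact tendsto_const_nhds.sub hν
    have h4 := h3.sqrt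
    simp only [Real.sqrt_sq (norm_nonneg _), Real.sqrt_zero] at h4
    exact tendsto_iff_norm_sub_tendsto_zero.2 h4
  · rw [scalarMeasure_apply _ x hs]
    simp only [if_pos hs]
    rw [(hP s hs x).1, Complex.ofReal_re, Measure.real, ENNReal.ofReal_toReal (measure_ne_top _ _)]

end SpectralMeasure

namespace SpectralMeasure

open MeasureTheory Filter Topology CompactlySupported

variable {H : Type*} [NormedAddCommGroup H] [InnerProductSpace ℂ H] [CompleteSpace H]

/-! ### From a continuous functional calculus to a Borel functional calculus -/

section Calculus

variable {X : Type*} [TopologicalSpace X] (Φ : C(X, ℝ) →⋆ₐ[ℝ] H →L[ℂ] H)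

theorem isSelfAdjoint_calculus (f : C(X, ℝ)) : IsSelfAdjoint (Φ f) :=
  (show IsSelfAdjoint f from ContinuousMap.ext fun _ => rfl).map Φ

theorem calculus_mul_apply (f g : C(X, ℝ)) (x : H) : Φ (f * g) x = Φ f (Φ g x) := by
  rw [map_mul]; rfl

theorem inner_calculus_mul_self (f : C(X, ℝ)) (x : H) :
    inner ℂ x (Φ (f * f) x) = ((‖Φ f x‖ ^ 2 : ℝ) : ℂ) := by
  rw [calculus_mul_apply, ← (isSelfAdjoint_calculus Φ f).inner_apply_left,
    inner_self_eq_norm_sq_to_K]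
  norm_cast

theorem norm_sq_calculus_apply [MeasurableSpace X] {Φ : C(X, ℝ) →⋆ₐ[ℝ] H →L[ℂ] H}
    {μ : H → Measure X}
    (hμ : ∀ x (f : C(X, ℝ)), ((∫ a, f a ∂μ x : ℝ) : ℂ) = inner ℂ x (Φ f x))
    (f : C(X, ℝ)) (x : H) : ‖Φ f x‖ ^ 2 = ∫ a, f a ^ 2 ∂μ x := by
  have h := hμ x (f * f)
  rw [inner_calculus_mul_self] at h
  simp only [sq, ContinuousMap.mul_apply] at h ⊢
  exact_mod_cast h.symm

theorem measure_calculus_real_univ [MeasurableSpace X] {Φ : C(X, ℝ) →⋆ₐ[ℝ] H →L[ℂ] H}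
    {μ : H → Measure X}
    (hμ : ∀ x (f : C(X, ℝ)), ((∫ a, f a ∂μ x : ℝ) : ℂ) = inner ℂ x (Φ f x))
    (x : H) : (μ x).real Set.univ = ‖x‖ ^ 2 := by
  have h := norm_sq_calculus_apply hμ 1 x
  rw [map_one] at h
  simpa using h.symm

end Calculus

section BorelCalculus

variable {X : Type*} [MetricSpace X] [CompactSpace X] [MeasurableSpace X] [BorelSpace X]

/-- The measure of a vector `x`, given by the Riesz–Markov–Kakutani theorem. -/
theorem exists_measure_calculus (Φ : C(X, ℝ) →⋆ₐ[ℝ] H →L[ℂ] H) (x : H) :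
    ∃ μ : Measure X, IsFiniteMeasure μ ∧
      ∀ f : C(X, ℝ), ((∫ a, f a ∂μ : ℝ) : ℂ) = inner ℂ x (Φ f x) := by
  let Λ : C_c(X, ℝ) →ₚ[ℝ] ℝ := PositiveLinearMap.mk₀
    { toFun := fun f => (inner ℂ x (Φ (f : C(X, ℝ)) x)).re
      map_add' := fun f g => by
        change (inner ℂ x (Φ ((f : C(X, ℝ)) + (g : C(X, ℝ))) x)).re = _
        rw [map_add, _root_.add_apply, inner_add_right, Complex.add_re]
      map_smul' := fun c f => by
        change (inner ℂ x (Φ (c • (f : C(X, ℝ))) x)).re = c * _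
        rw [map_smul, _root_.smul_apply, ← Complex.coe_smul, inner_smul_right,
          Complex.re_ofReal_mul] } (fun f hf => by
      let g : C(X, ℝ) := ⟨fun a => √(f a), by fun_prop⟩
      have h1 : (f : C(X, ℝ)) = g * g :=
        ContinuousMap.ext fun a => (Real.mul_self_sqrt (hf a)).symm
      change 0 ≤ (inner ℂ x (Φ (f : C(X, ℝ)) x)).re
      rw [h1, inner_calculus_mul_self, Complex.ofReal_re]
      positivity)
  refine ⟨RealRMK.rieszMeasure Λ, inferInstance, fun f => ?_⟩
  have h1 := RealRMK.integral_rieszMeasure Λ (CompactlySupportedContinuousMap.continuousMapEquiv f)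
  change ∫ a, f a ∂_ = (inner ℂ x (Φ f x)).re at h1
  rw [h1, ← Complex.conj_eq_iff_re, inner_conj_symm, (isSelfAdjoint_calculus Φ f).inner_apply_left]

variable {Φ : C(X, ℝ) →⋆ₐ[ℝ] H →L[ℂ] H} {μ : H → Measure X}

theorem norm_calculus_apply [∀ x, IsFiniteMeasure (μ x)]
    (hμ : ∀ x (f : C(X, ℝ)), ((∫ a, f a ∂μ x : ℝ) : ℂ) = inner ℂ x (Φ f x))
    (f : C(X, ℝ)) (x : H) :
    ‖Φ f x‖ = ‖ContinuousMap.toLp 2 (μ x) ℝ f‖ := by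
  rw [← sq_eq_sq₀ (norm_nonneg _) (norm_nonneg _), norm_sq_calculus_apply hμ,
    ← real_inner_self_eq_norm_sq, ContinuousMap.inner_toLp]
  simp [sq]

/-- The isometry `f ↦ Φ f x` from `L²(μ x)`, extended from continuous functions to a given
element `u` of `L²(μ x)`. -/
theorem exists_calculus_extension [∀ x, IsFiniteMeasure (μ x)]
    (hμ : ∀ x (f : C(X, ℝ)), ((∫ a, f a ∂μ x : ℝ) : ℂ) = inner ℂ x (Φ f x))
    (x : H) (u : Lp ℝ 2 (μ x)) :
    ∃ h : H, (∀ f : C(X, ℝ), ‖h - Φ f x‖ = ‖u - ContinuousMap.toLp 2 (μ x) ℝ f‖) ∧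
      (inner ℂ x h).im = 0 := by
  have hdist : ∀ f g : C(X, ℝ), ‖Φ f x - Φ g x‖ =
      ‖ContinuousMap.toLp 2 (μ x) ℝ f - ContinuousMap.toLp 2 (μ x) ℝ g‖ := by
    intro f g
    rw [← map_sub, ← norm_calculus_apply hμ, map_sub, _root_.sub_apply]
  obtain ⟨v, hv, hlim⟩ := mem_closure_iff_seq_limit.1
    ((ContinuousMap.toLp_denseRange ℝ (μ x) ℝ (by simp : (2 : ENNReal) ≠ ⊤)) u)
  choose f hf using hv
  have hc : CauchySeq fun n => Φ (f n) x := by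
    have h1 := hlim.cauchySeq
    rw [Metric.cauchySeq_iff] at h1 ⊢
    intro ε hε
    obtain ⟨N, hN⟩ := h1 ε hε
    refine ⟨N, fun m hm n hn => ?_⟩
    rw [dist_eq_norm, hdist, hf, hf, ← dist_eq_norm]
    exact hN m hm n hn
  obtain ⟨h, hh⟩ := cauchySeq_tendsto_of_complete hc
  refine ⟨h, fun g => ?_, ?_⟩
  · refine tendsto_nhds_unique (hh.sub_const (Φ g x)).norm ?_
    simp only [hdist, hf]
    exact (hlim.sub_const _).norm
  · refine tendsto_nhds_unique ((Complex.continuous_im.tendsto _).comp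
      (tendsto_const_nhds.inner hh)) ?_
    simp only [Function.comp_def, ← hμ, Complex.ofReal_im]
    exact tendsto_const_nhds

/-- The operator assigned to the indicator function of `s` by the Borel functional calculus. -/
theorem exists_clm_indicator [∀ x, IsFiniteMeasure (μ x)]
    (hμ : ∀ x (f : C(X, ℝ)), ((∫ a, f a ∂μ x : ℝ) : ℂ) = inner ℂ x (Φ f x))
    {s : Set X} (hs : MeasurableSet s) :
    ∃ P : H →L[ℂ] H, ∀ x, inner ℂ x (P x) = (((μ x).real s : ℝ) : ℂ) ∧
      ‖P x‖ ^ 2 = (μ x).real s := by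
  let u : ∀ x, Lp ℝ 2 (μ x) := fun x => indicatorConstLp 2 hs (measure_ne_top _ _) 1
  choose P hP hPim using fun x => exists_calculus_extension hμ x (u x)
  have hnorm : ∀ x, ‖P x‖ ^ 2 = (μ x).real s := by
    intro x
    have h1 := hP x 0
    rw [map_zero, map_zero, _root_.zero_apply, sub_zero, sub_zero,
      norm_indicatorConstLp (by simp) (by simp)] at h1
    rw [h1, norm_one, one_mul, ← Real.rpow_natCast, ← Real.rpow_mul measureReal_nonneg]
    simp
  have hinner : ∀ x, inner ℂ x (P x) = (((μ x).real s : ℝ) : ℂ) := by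
    intro x
    have h1 := hP x 1
    have h2 : u x - ContinuousMap.toLp 2 (μ x) ℝ 1 =
        -indicatorConstLp 2 hs.compl (measure_ne_top (μ x) _) 1 := by
      have h3 : ContinuousMap.toLp 2 (μ x) ℝ (1 : C(X, ℝ)) =
          indicatorConstLp 2 .univ (measure_ne_top (μ x) _) 1 := by
        refine Lp.ext ?_
        filter_upwards [ContinuousMap.coeFn_toLp (p := 2) (𝕜 := ℝ) (μ x) (1 : C(X, ℝ)),
          indicatorConstLp_coeFn (p := 2) (μ := μ x) (hs := MeasurableSet.univ)
            (hμs := measure_ne_top _ _) (c := (1 : ℝ))] with a h4 h5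
        rw [h4, h5]
        simp
      have h4 := indicatorConstLp_disjoint_union (p := 2) hs hs.compl (measure_ne_top (μ x) _)
        (measure_ne_top (μ x) _) disjoint_compl_right (1 : ℝ)
      simp only [Set.union_compl_self] at h4
      rw [h3, h4]
      simp only [u]
      abel
    rw [map_one, one_apply_eq_self, h2, norm_neg, norm_indicatorConstLp (by simp) (by simp)] at h1
    have h3 : ‖P x - x‖ ^ 2 = (μ x).real sᶜ := by
      rw [h1, norm_one, one_mul, ← Real.rpow_natCast, ← Real.rpow_mul measureReal_nonneg]
      simp
    rw [measureReal_compl hs, measure_calculus_real_univ hμ, ← hnorm] at h3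
    have h4 : ‖P x - x‖ ^ 2 = ‖P x‖ ^ 2 - 2 * (inner ℂ (P x) x).re + ‖x‖ ^ 2 :=
      norm_sub_sq (𝕜 := ℂ) (P x) x
    have h5 : (inner ℂ (P x) x).re = (inner ℂ x (P x)).re := inner_re_symm (𝕜 := ℂ) _ _
    refine Complex.ext ?_ (by rw [hPim, Complex.ofReal_im])
    rw [Complex.ofReal_re, ← hnorm]
    linarith
  -- linearity: a single continuous function approximates the indicator in all relevant `L²` spaces
  have happrox : ∀ (ν : Measure X) [IsFiniteMeasure ν] (ε : ℝ), 0 < ε → ∃ f : C(X, ℝ),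
      ∀ x, μ x ≤ ν → ‖P x - Φ f x‖ ≤ ε := by
    intro ν _ ε hε
    obtain ⟨f, hf, -⟩ := ((memLp_indicator_const 2 hs (1 : ℝ)
      (Or.inr (measure_ne_top ν s))).exists_boundedContinuous_eLpNorm_sub_le (by simp)
      (ENNReal.ofReal_pos.2 hε).ne')
    refine ⟨f.toContinuousMap, fun x hx => ?_⟩
    rw [hP, Lp.norm_def]
    refine ENNReal.toReal_le_of_le_ofReal hε.le (le_trans (le_of_eq ?_)
      ((eLpNorm_mono_measure _ hx).trans hf))
    refine eLpNorm_congr_ae ?_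
    filter_upwards [Lp.coeFn_sub (u x) (ContinuousMap.toLp 2 (μ x) ℝ f.toContinuousMap),
      ContinuousMap.coeFn_toLp (p := 2) (𝕜 := ℝ) (μ x) f.toContinuousMap,
      indicatorConstLp_coeFn (p := 2) (μ := μ x) (hs := hs)
        (hμs := measure_ne_top _ _) (c := (1 : ℝ))] with a h1 h2 h3
    rw [h1, Pi.sub_apply, h2, h3]
    rfl
  have hlin : ∀ (c : ℂ) (x y : H), P (c • x + y) = c • P x + P y := by
    intro c x y
    rw [← sub_eq_zero, ← norm_le_zero_iff]
    refine le_of_forall_pos_le_add fun ε hε => ?_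
    have hc : 0 < ‖c‖ + 2 := by positivity
    obtain ⟨f, hf⟩ := happrox (μ x + μ y + μ (c • x + y)) (ε / (‖c‖ + 2)) (by positivity)
    have h1 := hf x (by rw [add_assoc]; exact Measure.le_add_right le_rfl)
    have h2 := hf y (Measure.le_add_right (Measure.le_add_left le_rfl))
    have h3 := hf (c • x + y) (Measure.le_add_left le_rfl)
    calc ‖P (c • x + y) - (c • P x + P y)‖
        = ‖(P (c • x + y) - Φ f (c • x + y)) - (c • (P x - Φ f x) + (P y - Φ f y))‖ := by
          rw [map_add, map_smul, smul_sub]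
          congr 1
          abel
      _ ≤ ‖P (c • x + y) - Φ f (c • x + y)‖ + (‖c‖ * ‖P x - Φ f x‖ + ‖P y - Φ f y‖) := by
          refine (norm_sub_le _ _).trans ?_
          gcongr
          refine (norm_add_le _ _).trans ?_
          rw [norm_smul]
      _ ≤ ε / (‖c‖ + 2) + (‖c‖ * (ε / (‖c‖ + 2)) + ε / (‖c‖ + 2)) := by gcongr
      _ = 0 + ε := by field_simp; ring
  have hP0 : P 0 = 0 := by simpa using hlin 1 0 0
  let L : H →ₗ[ℂ] H :=
    { toFun := P
      map_add' := fun x y => by simpa using hlin 1 x y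
      map_smul' := fun c x => by simpa [hP0] using hlin c x 0 }
  refine ⟨L.mkContinuous 1 fun x => ?_, fun x => ⟨hinner x, hnorm x⟩⟩
  change ‖P x‖ ≤ 1 * ‖x‖
  rw [one_mul, ← sq_le_sq₀ (norm_nonneg _) (norm_nonneg _), hnorm,
    ← measure_calculus_real_univ hμ]
  exact measureReal_mono (Set.subset_univ s)

/-- The measure of `Φ f y` has density `f²` with respect to the measure of `y`. -/
theorem measure_calculus_apply [∀ x, IsFiniteMeasure (μ x)]
    (hμ : ∀ x (f : C(X, ℝ)), ((∫ a, f a ∂μ x : ℝ) : ℂ) = inner ℂ x (Φ f x))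
    (f : C(X, ℝ)) (y : H) :
    μ (Φ f y) = (μ y).withDensity fun a => ENNReal.ofReal (f a ^ 2) := by
  have hm : Measurable fun a => ENNReal.ofReal (f a ^ 2) :=
    (f.continuous.pow 2).measurable.ennreal_ofReal
  have hfin : IsFiniteMeasure ((μ y).withDensity fun a => ENNReal.ofReal (f a ^ 2)) := by
    have hi : Integrable (fun a => f a ^ 2) (μ y) :=
      (f.continuous.pow 2).integrable_of_hasCompactSupport (HasCompactSupport.of_compactSpace _)
    exact isFiniteMeasure_withDensity_ofReal hi.hasFiniteIntegral
  refine ext_of_forall_integral_eq_of_IsFiniteMeasure fun g => ?_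
  rw [integral_withDensity_eq_integral_toReal_smul hm (.of_forall fun _ => ENNReal.ofReal_lt_top)]
  have h1 := hμ (Φ f y) g.toContinuousMap
  have h2 := hμ y (f * (g.toContinuousMap * f))
  rw [calculus_mul_apply, calculus_mul_apply, ← (isSelfAdjoint_calculus Φ f).inner_apply_left,
    ← h1] at h2
  have h3 := Complex.ofReal_injective h2
  refine h3.symm.trans (integral_congr_ae (.of_forall fun a => ?_))
  simp only [ContinuousMap.mul_apply, smul_eq_mul, ENNReal.toReal_ofReal (sq_nonneg (f a))]
  change f a * (g a * f a) = _
  ring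

end BorelCalculus

end SpectralMeasure

namespace SpectralMeasure

open MeasureTheory Filter Topology
open LinearPMap hiding map_add map_sub map_zero map_smul map_neg

variable {H : Type*} [NormedAddCommGroup H] [InnerProductSpace ℂ H] [CompleteSpace H]

/-! ### The spectral theorem for positive selfadjoint operators -/

/-- The point `0` carries no mass when the operator with functional calculus `Φ` is injective. -/
theorem measure_setOf_eq_zero {X : Type*} [MetricSpace X] [CompactSpace X] [MeasurableSpace X]
    [BorelSpace X] {Φ : C(X, ℝ) →⋆ₐ[ℝ] H →L[ℂ] H} {μ : H → Measure X}
    [∀ x, IsFiniteMeasure (μ x)]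
    (hμ : ∀ x (f : C(X, ℝ)), ((∫ a, f a ∂μ x : ℝ) : ℂ) = inner ℂ x (Φ f x))
    (f : C(X, ℝ)) (hf : Function.Injective (Φ f)) (x : H) : μ x {a | f a = 0} = 0 := by
  have hs : MeasurableSet {a | f a = 0} := (isClosed_eq f.continuous continuous_const).measurableSet
  obtain ⟨P, hP⟩ := exists_clm_indicator hμ hs
  have hP0 : P x = 0 := by
    refine ((isSelfAdjoint_calculus Φ f).denseRange_of_injective hf).induction_on
      (p := fun x => P x = 0) x (isClosed_eq P.continuous continuous_const) fun y => ?_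
    have h1 := (hP (Φ f y)).2
    rw [measure_calculus_apply hμ, Measure.real, withDensity_apply _ hs,
      setLIntegral_congr_fun (g := fun _ => 0) hs (fun a ha => by
        rw [Set.mem_ofPred_eq] at ha
        simp [ha])] at h1
    simpa using h1
  have h2 := (hP x).2
  rw [hP0, norm_zero, sq, mul_zero] at h2
  exact (measureReal_eq_zero_iff).1 h2.symm

/-- Every positive selfadjoint operator `R` has a spectral measure, namely the image of that of
`K = (I + R)⁻¹` under `k ↦ k⁻¹ - 1`. -/
theorem _root_.LinearPMap.IsPositiveSelfAdjoint.exists_isSpectralMeasureOf {R : H →ₗ.[ℂ] H}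
    (hR : R.IsPositiveSelfAdjoint) : ∃ E : SpectralMeasure H, E.IsSpectralMeasureOf R := by
  obtain ⟨K, hK, hKi, hKR⟩ := hR.exists_resolvent
  let Φ : C(spectrum ℝ K, ℝ) →⋆ₐ[ℝ] H →L[ℂ] H := cfcHom hK
  let ι : C(spectrum ℝ K, ℝ) := ContinuousMap.restrict (spectrum ℝ K) (.id ℝ)
  have hι : Φ ι = K := cfcHom_id hK
  choose μ hfin hμ using exists_measure_calculus Φ
  let ψ : spectrum ℝ K → ℝ := fun k => (k : ℝ)⁻¹ - 1
  have hψ : Measurable ψ := by fun_prop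
  obtain ⟨E, hE⟩ := exists_scalarMeasure_eq (fun x => (μ x).map ψ)
    (fun x => by
      rw [map_measureReal_apply hψ .univ, Set.preimage_univ, measure_calculus_real_univ hμ])
    (fun s hs => by
      obtain ⟨P, hP⟩ := exists_clm_indicator hμ (hψ hs)
      exact ⟨P, fun x => by rw [map_measureReal_apply hψ hs]; exact hP x⟩)
  have hdens : ∀ y, μ (K y) = (μ y).withDensity fun k => ENNReal.ofReal ((k : ℝ) ^ 2) := by
    intro y
    have h := measure_calculus_apply hμ ι y
    rw [hι] at h
    exact h
  have hm : Measurable fun k : spectrum ℝ K => ENNReal.ofReal ((k : ℝ) ^ 2) := by fun_prop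
  -- membership in the domain: `R` is selfadjoint, so it suffices to bound `⟨x, R z⟩` by `‖z‖`
  have hdom : ∀ x, Integrable (fun k => ψ k ^ 2) (μ x) → x ∈ R.domain := by
    intro x hx
    -- `g n` approximates `k⁻¹` and vanishes at `0`
    let g : ℕ → C(spectrum ℝ K, ℝ) := fun n =>
      ⟨fun k => k / ((k : ℝ) ^ 2 + 1 / ((n : ℝ) + 1)),
        Continuous.div (by fun_prop) (by fun_prop) fun k => by positivity⟩
    have hg : ∀ n k, g n k = k / ((k : ℝ) ^ 2 + 1 / ((n : ℝ) + 1)) := fun n k => rfl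
    have hinv : Integrable (fun k : spectrum ℝ K => ((k : ℝ)⁻¹) ^ 2) (μ x) := by
      refine ((hx.const_mul 2).add (integrable_const 2)).mono' (by fun_prop)
        (.of_forall fun k => ?_)
      rw [Real.norm_of_nonneg (sq_nonneg _)]
      simp only [Pi.add_apply, ψ]
      nlinarith [sq_nonneg ((k : ℝ)⁻¹ - 2)]
    have hgle : ∀ n k, g n k ^ 2 ≤ ((k : ℝ)⁻¹) ^ 2 := by
      intro n k
      rw [hg, sq_le_sq, abs_div, abs_inv,
        abs_of_pos (by positivity : 0 < (k : ℝ) ^ 2 + 1 / ((n : ℝ) + 1))]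
      rcases eq_or_ne (k : ℝ) 0 with h0 | h0
      · simp [h0]
      · rw [div_le_iff₀ (by positivity), ← sq_abs]
        have hk := abs_pos.2 h0
        have : 0 < 1 / ((n : ℝ) + 1) := by positivity
        rw [mul_add, sq, inv_mul_cancel_left₀ hk.ne']
        exact le_add_of_nonneg_right (by positivity)
    have hgnorm : ∀ n, ‖Φ (g n) x‖ ≤ √(∫ k, ((k : ℝ)⁻¹) ^ 2 ∂μ x) := by
      intro n
      refine Real.le_sqrt_of_sq_le ?_
      rw [norm_sq_calculus_apply hμ]
      exact integral_mono_of_nonneg (.of_forall fun k => sq_nonneg _) hinv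
        (.of_forall fun k => hgle n k)
    have hlim : Tendsto (fun n => K (Φ (g n) x)) atTop (𝓝 x) := by
      have h1 : ∀ n, ‖K (Φ (g n) x) - x‖ ^ 2 =
          ∫ k, ((ι * g n - 1 : C(spectrum ℝ K, ℝ)) k) ^ 2 ∂μ x := by
        intro n
        rw [← norm_sq_calculus_apply hμ, map_sub, map_one, _root_.sub_apply, calculus_mul_apply, hι,
          one_apply_eq_self]
      have h2 : Tendsto (fun n => ‖K (Φ (g n) x) - x‖ ^ 2) atTop (𝓝 0) := by
        simp only [h1]
        have h3 : ∀ n (k : spectrum ℝ K), (ι * g n - 1 : C(spectrum ℝ K, ℝ)) k =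
            -((1 / ((n : ℝ) + 1)) / ((k : ℝ) ^ 2 + 1 / ((n : ℝ) + 1))) := by
          intro n k
          change (k : ℝ) * g n k - 1 = _
          have : (k : ℝ) ^ 2 + 1 / ((n : ℝ) + 1) ≠ 0 := by positivity
          rw [hg, mul_div_assoc', div_sub_one this, ← neg_div]
          congr 1
          ring
        rw [← integral_zero (spectrum ℝ K) ℝ (μ := μ x)]
        refine tendsto_integral_of_dominated_convergence (fun _ => 1)
          (fun n => ((ι * g n - 1 : C(spectrum ℝ K, ℝ)).continuous.pow 2).aestronglyMeasurable)
          (integrable_const 1) (fun n => .of_forall fun k => ?_) ?_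
        · rw [h3, neg_sq, Real.norm_of_nonneg (sq_nonneg _)]
          refine pow_le_one₀ (by positivity) (div_le_one_of_le₀ ?_ (by positivity))
          exact le_add_of_nonneg_left (sq_nonneg _)
        · have h4 := measure_setOf_eq_zero hμ ι (by rwa [hι]) x
          filter_upwards [measure_eq_zero_iff_ae_notMem.1 h4] with k hk
          have hk0 : (k : ℝ) ≠ 0 := hk
          simp only [h3]
          have h5 := tendsto_one_div_add_atTop_nhds_zero_nat (𝕜 := ℝ)
          have h6 := ((h5.div (h5.const_add ((k : ℝ) ^ 2)) (by simpa using hk0)).neg).pow 2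
          simpa using h6
      have h3 := h2.sqrt
      simp only [Real.sqrt_sq (norm_nonneg _), Real.sqrt_zero] at h3
      exact tendsto_iff_norm_sub_tendsto_zero.2 h3
    rw [← isSelfAdjoint_def.1 hR.1, mem_adjoint_domain_iff]
    refine AddMonoidHomClass.continuous_of_bound _
      (√(∫ k, ((k : ℝ)⁻¹) ^ 2 ∂μ x) + ‖x‖) fun z => ?_
    change ‖inner ℂ x (R z)‖ ≤ _ * ‖(z : H)‖
    have h1 : K (z + R z) = z := (hKR _ _).1 (mem_graph R z)
    have h2 : ‖inner ℂ x ((z : H) + R z)‖ ≤ √(∫ k, ((k : ℝ)⁻¹) ^ 2 ∂μ x) * ‖(z : H)‖ := by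
      refine le_of_tendsto (hlim.inner (tendsto_const_nhds (x := (z : H) + R z))).norm
        (.of_forall fun n => ?_)
      rw [hK.inner_apply_left, h1]
      exact (norm_inner_le_norm _ _).trans (by gcongr; exact hgnorm n)
    calc ‖inner ℂ x (R z)‖ = ‖inner ℂ x ((z : H) + R z) - inner ℂ x (z : H)‖ := by
          rw [inner_add_right, add_sub_cancel_left]
      _ ≤ √(∫ k, ((k : ℝ)⁻¹) ^ 2 ∂μ x) * ‖(z : H)‖ + ‖x‖ * ‖(z : H)‖ :=
          (norm_sub_le _ _).trans (add_le_add h2 (norm_inner_le_norm _ _))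
      _ = _ := by ring
  refine ⟨E, fun x => ?_, fun x => ?_⟩
  · rw [hE, integrable_map_measure (by fun_prop) hψ.aemeasurable]
    refine ⟨fun hx => ?_, hdom x⟩
    have h1 : K (x + R ⟨x, hx⟩) = x := (hKR _ _).1 (mem_graph R ⟨x, hx⟩)
    rw [← h1, hdens, integrable_withDensity_iff_integrable_smul' hm
      (.of_forall fun _ => ENNReal.ofReal_lt_top)]
    have hbd : ∃ M, ∀ k : spectrum ℝ K, |(k : ℝ)| ≤ M := by
      obtain ⟨M, hM⟩ := isCompact_univ.exists_bound_of_continuousOn ι.continuous.continuousOn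
      exact ⟨M, fun k => hM k trivial⟩
    obtain ⟨M, hM⟩ := hbd
    refine (integrable_const ((1 + M) ^ 2)).mono' ?_ (.of_forall fun k => ?_)
    · exact (hm.ennreal_toReal.mul (by fun_prop)).aestronglyMeasurable
    · rw [ENNReal.toReal_ofReal (sq_nonneg _), smul_eq_mul, Function.comp_apply, ← mul_pow,
        norm_pow, Real.norm_eq_abs]
      refine pow_le_pow_left₀ (abs_nonneg _) ?_ 2
      simp only [ψ]
      rw [mul_sub, mul_one]
      refine (abs_sub _ _).trans (add_le_add ?_ (hM k))
      rcases eq_or_ne (k : ℝ) 0 with h0 | h0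
      · simp [h0]
      · simp [mul_inv_cancel₀ h0]
  · have h1 : K (x + R x) = x := (hKR _ _).1 (mem_graph R x)
    set y : H := x + R x
    have h2 : R x = y - K y := by rw [h1]; simp [y]
    rw [hE, integral_map hψ.aemeasurable (by fun_prop), h2, ← h1, hdens,
      integral_withDensity_eq_integral_toReal_smul hm (.of_forall fun _ => ENNReal.ofReal_lt_top)]
    have h3 := hμ y (ι * (1 - ι))
    rw [calculus_mul_apply, map_sub, map_one, hι, ← hK.inner_apply_left] at h3
    rw [show y - K y = (1 - K) y from rfl, ← h3]
    congr 1
    refine integral_congr_ae (.of_forall fun k => ?_)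
    change (k : ℝ) * (1 - k) = (ENNReal.ofReal ((k : ℝ) ^ 2)).toReal • ((k : ℝ)⁻¹ - 1)
    rw [ENNReal.toReal_ofReal (sq_nonneg _), smul_eq_mul]
    rcases eq_or_ne (k : ℝ) 0 with h0 | h0
    · simp [h0]
    · field_simp

end SpectralMeasure

/-! ### Equivalence of the conditions -/

theorem LinearPMap.modulus_isSquareRootOf {H : Type*} [NormedAddCommGroup H]
    [InnerProductSpace ℂ H] [CompleteSpace H] {C : H →ₗ.[ℂ] H}
    (h : ∃ R : H →ₗ.[ℂ] H, R.IsSquareRootOf (C† ∘ₚ C)) :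
    C.modulus.IsSquareRootOf (C† ∘ₚ C) := by
  rw [modulus, dif_pos h]
  exact h.choose_spec

theorem LinearPMap.IsPositiveSelfAdjoint.isSpectralMeasureOf_spectralMeasure {H : Type*}
    [NormedAddCommGroup H] [InnerProductSpace ℂ H] [CompleteSpace H] {R : H →ₗ.[ℂ] H}
    (hR : R.IsPositiveSelfAdjoint) : R.spectralMeasure.IsSpectralMeasureOf R := by
  have h := hR.exists_isSpectralMeasureOf
  rw [spectralMeasure, dif_pos h]
  exact h.choose_spec

theorem theorem3p1 {H : Type*} [NormedAddCommGroup H] [InnerProductSpace ℂ H] [CompleteSpace H]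
    (C : H →ₗ.[ℂ] H) (hclosed : C.IsClosed) (hdense : Dense (C.domain : Set H)) :
    -- the objects in the four conditions are well defined
    Function.Bijective ((1 : H →L[ℂ] H).everywhere + C† ∘ₚ C) ∧
    C.modulus.IsSquareRootOf (C† ∘ₚ C) ∧
    C.modulus.spectralMeasure.IsSpectralMeasureOf C.modulus ∧
    -- the equivalence
    List.TFAE [
      C ∘ₚ C† ∘ₚ C ≤ C† ∘ₚ C ∘ₚ C,
      C ∘ₚ C† ∘ₚ C = C† ∘ₚ C ∘ₚ C,
      C.resolventStarMul ∘ₚ C ≤ C ∘ₚ C.resolventStarMul,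
      C.modulus.spectralMeasure.CommutesWith C] ∧
    -- the two definitions of quasinormality coincide
    (C.IsKaufmanQuasinormal ↔ C.IsQuasinormal) := by
  obtain ⟨T, B, hTB, hB⟩ := LinearPMap.exists_resolvent hclosed hdense
  have hTs := LinearPMap.isSelfAdjoint_resolvent hdense hTB
  have hmod := LinearPMap.modulus_isSquareRootOf
    (LinearPMap.exists_isSquareRootOf_starMul hdense hTB)
  have hE := hmod.1.isSpectralMeasureOf_spectralMeasure
  have hT : ∀ x y, (x, y) ∈ (C.modulus ∘ₚ C.modulus).graph ↔ T (x + y) = x := fun x y => by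
    rw [hmod.2, LinearPMap.mem_graph_starMul_iff hdense hTB]
  have hres : C.resolventStarMul ∘ₚ C ≤ C ∘ₚ C.resolventStarMul ↔ Commute T B := by
    rw [LinearPMap.resolventStarMul_eq hdense hTB, LinearPMap.everywhere_pcomp_le_iff,
      LinearPMap.commute_resolvent_iff hdense hTB hB]
  have hcomm : C.modulus.spectralMeasure.CommutesWith C ↔ ∀ Δ, MeasurableSet Δ → ∀ x y,
      (x, y) ∈ C.graph →
        (C.modulus.spectralMeasure.proj Δ x, C.modulus.spectralMeasure.proj Δ y) ∈ C.graph :=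
    forall₂_congr fun Δ _ => LinearPMap.everywhere_pcomp_le_iff
  have htfae : List.TFAE [
      C ∘ₚ C† ∘ₚ C ≤ C† ∘ₚ C ∘ₚ C,
      C ∘ₚ C† ∘ₚ C = C† ∘ₚ C ∘ₚ C,
      C.resolventStarMul ∘ₚ C ≤ C ∘ₚ C.resolventStarMul,
      C.modulus.spectralMeasure.CommutesWith C] := by
    tfae_have 2 → 1 := fun h => h.le
    tfae_have 1 → 3 := fun h => hres.2 ((LinearPMap.commute_resolvent_iff hdense hTB hB).1
      fun _ _ hxy => LinearPMap.resolvent_apply_mem_graph_of_le hdense hTB h hxy)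
    tfae_have 3 → 2 := fun h => LinearPMap.eq_of_commute_resolvent hdense hTB hB (hres.1 h)
    tfae_have 3 → 4 := fun h => hcomm.2 fun Δ hΔ _ _ hxy =>
      LinearPMap.apply_mem_graph_of_commute hdense hTB hB
        (C.modulus.spectralMeasure.isSelfAdjoint_proj Δ)
        (hE.commute_proj hmod.1 hT hTs (Commute.refl T) hΔ).symm
        (hE.commute_proj hmod.1 hT hTs (hres.1 h).symm hΔ).symm hxy
    tfae_have 4 → 3 := fun h => by
      refine hres.2 (hE.commute_resolvent hmod.1.1 hT fun Δ hΔ => ?_).symm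
      have h1 := hE.commute_proj hmod.1 hT hTs (Commute.refl T) hΔ
      ext x
      -- `E(Δ) B = E(Δ) C T ⊆ C E(Δ) T = C T E(Δ) = B E(Δ)`
      refine (LinearPMap.mem_graph_snd_inj _ (hcomm.1 h Δ hΔ _ _ (hTB x).1)
        (hTB (C.modulus.spectralMeasure.proj Δ x)).1 ?_).symm
      exact congrArg (fun S : H →L[ℂ] H => S x) h1.eq.symm
    tfae_finish
  refine ⟨LinearPMap.bijective_one_add_starMul hdense hTB, hmod, hE, htfae, ?_⟩
  exact and_congr_right fun _ => and_congr_right fun _ => htfae.out 1 3
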